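/- Let $M\subset\mathbb{C}^3$ be a real-analytic ($\mathcal{C}^\omega$) embedded real hypersurface (of real dimension $5$) whose Levi form $$T^{1,0}_pM\times T^{1,0}_pM\to \mathbb{C}\otimes T_pM \bmod (T^{1,0}_pM\oplus T^{0,1}_pM),\qquad (\mathcal{M}_p,\mathcal{N}_p)\mapsto \sqrt{-1}\,[\mathcal{M},\overline{\mathcal{N}}](p),$$ has complex rank $1$ at every point $p\in M$; here $\mathcal{M},\mathcal{N}$ are any local $\mathcal{C}^\omega$ sections of $T^{1,0}M$ extending $\mathcal{M}_p,\mathcal{N}_p$. Let $K^{1,0}M\subset T^{1,0}M$ be the complex line bundle of kernels of the Levi form, and let the Freeman form of $M$ at $p$ be $$(\mathcal{K}_p,\mathcal{L}_p)\mapsto [\mathcal{K},\overline{\mathcal{L}}](p) \bmod (K^{1,0}_pM\oplus T^{0,1}_pM),$$ where $\mathcal{K}$ and $\mathcal{L}$ are any local $\mathcal{C}^\omega$ sections of $K^{1,0}M$ and $T^{1,0}M$ extending $\mathcal{K}_p\in K^{1,0}_pM$ and $\mathcal{L}_p\in T^{1,0}_pM$. Then the Freeman form of $M$ vanishes at every point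 of $M$ if and only if $M$ is, locally near each of its points, biholomorphic to a product $M^3\times\mathbb{C}$ with $M^3\subset\mathbb{C}^2$ a $\mathcal{C}^\omega$ real hypersurface; that is, for every $p\in M$ there are a biholomorphism $h:U\to U'$ from an open neighbourhood $U$ of $p$ in $\mathbb{C}^3$ onto an open set $U'\subset\mathbb{C}^3$ and a $\mathcal{C}^\omega$ real hypersurface $M^3\subset\mathbb{C}^2_{(z_1,w)}$ with $h(M\cap U)=U'\cap (M^3\times\mathbb{C}_{z_2})$. Moreover, in this case, near every $p\in M$ there are holomorphic coordinates $(z_1,z_2,w)$ centred at $p$, with $z_k=x_k+\sqrt{-1}\,y_k$ and $w=u+\sqrt{-1}\,v$, in which $M$ is a graph $v=\varphi(x_1,y_1,u)$ with $\varphi$ real-analytic, $\varphi(0)=0$, $d\varphi(0)=0$, and $\varphi$ independent of $(x_2,y_2)$. -/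

import Mathlib

open Filter Topology

noncomputable section

namespace CRGeom

variable {n : ℕ}

/-- `M ⊆ ℂⁿ` is an (embedded) real-analytic real hypersurface: near each of its points it is the
zero set of a real-analytic real-valued function with nowhere vanishing differential. -/
def IsRealAnalyticHypersurface (M : Set (Fin n → ℂ)) : Prop :=
  ∀ p ∈ M, ∃ U : Set (Fin n → ℂ), IsOpen U ∧ p ∈ U ∧ ∃ r : (Fin n → ℂ) → ℝ,
    AnalyticOnNhd ℝ r U ∧ (∀ q ∈ U, q ∈ M ↔ r q = 0) ∧ ∀ q ∈ U, fderiv ℝ r q ≠ 0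

/-! ### Complex tangent vectors and vector fields on `ℂⁿ = ℝ²ⁿ` -/

/-- The complexified tangent space `ℂ ⊗ T_p ℂⁿ = T^{1,0} ⊕ T^{0,1}`: the pair `(a, b)` stands for
the vector `∑ a_j ∂/∂z_j + ∑ b_j ∂/∂z̄_j`. -/
abbrev CVec (n : ℕ) : Type := (Fin n → ℂ) × (Fin n → ℂ)

/-- Complex vector fields on `ℂⁿ`. Only germs of fields at points matter below. -/
abbrev CField (n : ℕ) : Type := (Fin n → ℂ) → CVec n

/-- Complex conjugation on `ℂ ⊗ T_p ℂⁿ`; it exchanges `∂/∂z_j` and `∂/∂z̄_j`. -/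
def conjVec (v : CVec n) : CVec n := (star v.2, star v.1)

/-- `∂f/∂z_j = (∂f/∂x_j - i ∂f/∂y_j) / 2`. -/
def dz (j : Fin n) (f : (Fin n → ℂ) → ℂ) (p : Fin n → ℂ) : ℂ :=
  (fderiv ℝ f p (Pi.single j 1) - Complex.I * fderiv ℝ f p (Pi.single j Complex.I)) / 2

/-- `∂f/∂z̄_j = (∂f/∂x_j + i ∂f/∂y_j) / 2`. -/
def dzbar (j : Fin n) (f : (Fin n → ℂ) → ℂ) (p : Fin n → ℂ) : ℂ :=
  (fderiv ℝ f p (Pi.single j 1) + Complex.I * fderiv ℝ f p (Pi.single j Complex.I)) / 2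

/-- The derivative at `p` of the function `f` along the complex tangent vector `v`. -/
def along (v : CVec n) (f : (Fin n → ℂ) → ℂ) (p : Fin n → ℂ) : ℂ :=
  ∑ j, (v.1 j * dz j f p + v.2 j * dzbar j f p)

/-- The Lie bracket `[V, W]` at `p`: the coefficient of `[V, W]` on each coordinate field is
`V(W_k) - W(V_k)`. -/
def bracket (V W : CField n) (p : Fin n → ℂ) : CVec n :=
  (fun k => along (V p) (fun q => (W q).1 k) p - along (W p) (fun q => (V q).1 k) p,
   fun k => along (V p) (fun q => (W q).2 k) p - along (W p) (fun q => (V q).2 k) p)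

/-! ### The bundles `ℂ ⊗ TM`, `T^{1,0} M`, `T^{0,1} M` and their sections -/

lemma along_add_vec (v w : CVec n) (f : (Fin n → ℂ) → ℂ) (p : Fin n → ℂ) :
    along (v + w) f p = along v f p + along w f p := by
  simp only [along, ← Finset.sum_add_distrib]
  exact Finset.sum_congr rfl fun j _ => by simp; ring

lemma along_smul_vec (c : ℂ) (v : CVec n) (f : (Fin n → ℂ) → ℂ) (p : Fin n → ℂ) :
    along (c • v) f p = c * along v f p := by
  simp only [along, Finset.mul_sum]
  exact Finset.sum_congr rfl fun j _ => by simp; ring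

/-- `ℂ ⊗ T_p M`: the complex vectors that annihilate every real-analytic function germ at `p` which
vanishes on `M`. -/
def complexTangent (M : Set (Fin n → ℂ)) (p : Fin n → ℂ) : Submodule ℂ (CVec n) where
  carrier := {v | ∀ f : (Fin n → ℂ) → ℂ, AnalyticAt ℝ f p → (∀ᶠ q in 𝓝[M] p, f q = 0) →
    along v f p = 0}
  zero_mem' := fun f _ _ => by simp [along]
  add_mem' := fun {v w} hv hw f hf h0 => by rw [along_add_vec, hv f hf h0, hw f hf h0, add_zero]
  smul_mem' := fun c v hv f hf h0 => by rw [along_smul_vec, hv f hf h0, mul_zero]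

/-- `T^{1,0}_p M = T^{1,0}_p ℂⁿ ∩ (ℂ ⊗ T_p M)`. -/
def T10 (M : Set (Fin n → ℂ)) (p : Fin n → ℂ) : Submodule ℂ (CVec n) :=
  LinearMap.ker (LinearMap.snd ℂ (Fin n → ℂ) (Fin n → ℂ)) ⊓ complexTangent M p

/-- `T^{0,1}_p M = T^{0,1}_p ℂⁿ ∩ (ℂ ⊗ T_p M)`. -/
def T01 (M : Set (Fin n → ℂ)) (p : Fin n → ℂ) : Submodule ℂ (CVec n) :=
  LinearMap.ker (LinearMap.fst ℂ (Fin n → ℂ) (Fin n → ℂ)) ⊓ complexTangent M p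

/-- Local real-analytic sections near `p`, along `M`, of a family `B` of spaces of complex vectors.
A section is represented by a vector field that is real-analytic near `p` in `ℂⁿ` and takes values
in `B` on `M`; the bracket at `p` of two fields tangent to `M` depends only on their
restrictions to `M`. -/
def sections (M : Set (Fin n → ℂ)) (B : (Fin n → ℂ) → Submodule ℂ (CVec n)) (p : Fin n → ℂ) :
    Submodule ℂ (CField n) where
  carrier := {V | AnalyticAt ℝ V p ∧ ∀ᶠ q in 𝓝[M] p, V q ∈ B q}
  zero_mem' := ⟨analyticAt_const, Eventually.of_forall fun q => (B q).zero_mem⟩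
  add_mem' := fun {V W} hV hW => ⟨hV.1.add hW.1, by
    filter_upwards [hV.2, hW.2] with q h1 h2 using (B q).add_mem h1 h2⟩
  smul_mem' := fun c V hV => ⟨by
    have h : AnalyticAt ℝ (fun q => (c • (V q).1, c • (V q).2)) p :=
      AnalyticAt.prod
        (((c • ContinuousLinearMap.id ℂ (Fin n → ℂ)).restrictScalars ℝ).analyticAt _ |>.comp
          (((ContinuousLinearMap.fst ℝ (Fin n → ℂ) (Fin n → ℂ)).analyticAt _).comp hV.1))
        (((c • ContinuousLinearMap.id ℂ (Fin n → ℂ)).restrictScalars ℝ).analyticAt _ |>.comp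
          (((ContinuousLinearMap.snd ℝ (Fin n → ℂ) (Fin n → ℂ)).analyticAt _).comp hV.1))
    exact h, by
    filter_upwards [hV.2] with q h1 using (B q).smul_mem c h1⟩

/-! ### Levi form, Levi kernel, Freeman form -/

lemma dz_add {f g : (Fin n → ℂ) → ℂ} {p : Fin n → ℂ} (j : Fin n)
    (hf : DifferentiableAt ℝ f p) (hg : DifferentiableAt ℝ g p) :
    dz j (fun q => f q + g q) p = dz j f p + dz j g p := by
  simp only [dz, fderiv_fun_add hf hg, add_apply]; ring

lemma dzbar_add {f g : (Fin n → ℂ) → ℂ} {p : Fin n → ℂ} (j : Fin n)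
    (hf : DifferentiableAt ℝ f p) (hg : DifferentiableAt ℝ g p) :
    dzbar j (fun q => f q + g q) p = dzbar j f p + dzbar j g p := by
  simp only [dzbar, fderiv_fun_add hf hg, add_apply]; ring

lemma along_add {f g : (Fin n → ℂ) → ℂ} {p : Fin n → ℂ} (v : CVec n)
    (hf : DifferentiableAt ℝ f p) (hg : DifferentiableAt ℝ g p) :
    along v (fun q => f q + g q) p = along v f p + along v g p := by
  simp only [along, dz_add _ hf hg, dzbar_add _ hf hg, ← Finset.sum_add_distrib]
  exact Finset.sum_congr rfl fun j _ => by ring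

lemma along_const_mul {f : (Fin n → ℂ) → ℂ} {p : Fin n → ℂ} (v : CVec n) (c : ℂ)
    (hf : DifferentiableAt ℝ f p) :
    along v (fun q => c * f q) p = c * along v f p := by
  simp only [along, dz, dzbar, fderiv_const_mul hf, Finset.mul_sum]
  exact Finset.sum_congr rfl fun j _ => by simp; ring

lemma diff_fst {V : CField n} {p : Fin n → ℂ} (hV : AnalyticAt ℝ V p) (k : Fin n) :
    DifferentiableAt ℝ (fun q => (V q).1 k) p :=
  (differentiableAt_pi.1 hV.differentiableAt.fst) k

lemma diff_snd {V : CField n} {p : Fin n → ℂ} (hV : AnalyticAt ℝ V p) (k : Fin n) :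
    DifferentiableAt ℝ (fun q => (V q).2 k) p :=
  (differentiableAt_pi.1 hV.differentiableAt.snd) k

lemma bracket_add_left {V V' W : CField n} {p : Fin n → ℂ} (hV : AnalyticAt ℝ V p)
    (hV' : AnalyticAt ℝ V' p) : bracket (V + V') W p = bracket V W p + bracket V' W p := by
  ext k
  · simp only [bracket, Pi.add_apply, Prod.fst_add, along_add_vec,
      along_add _ (diff_fst hV k) (diff_fst hV' k)]; ring
  · simp only [bracket, Pi.add_apply, Prod.snd_add, along_add_vec,
      along_add _ (diff_snd hV k) (diff_snd hV' k)]; ring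

lemma bracket_smul_left {V W : CField n} {p : Fin n → ℂ} (c : ℂ) (hV : AnalyticAt ℝ V p) :
    bracket (c • V) W p = c • bracket V W p := by
  ext k
  · simp only [bracket, Pi.smul_apply, Prod.smul_fst, along_smul_vec, smul_eq_mul,
      along_const_mul _ c (diff_fst hV k)]; ring
  · simp only [bracket, Pi.smul_apply, Prod.smul_snd, along_smul_vec, smul_eq_mul,
      along_const_mul _ c (diff_snd hV k)]; ring

lemma bracket_antisymm (V W : CField n) (p : Fin n → ℂ) : bracket V W p = -bracket W V p := by
  ext k <;> simp [bracket]

/-- The conjugate `V̄` of a complex vector field. -/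
def conjField (V : CField n) : CField n := fun q => conjVec (V q)

lemma analyticAt_conjField {V : CField n} {p : Fin n → ℂ} (hV : AnalyticAt ℝ V p) :
    AnalyticAt ℝ (conjField V) p := by
  have hs : ∀ x, AnalyticAt ℝ (fun a : Fin n → ℂ => star a) x := fun x =>
    (starL' ℝ (A := Fin n → ℂ)).toContinuousLinearMap.analyticAt x
  exact AnalyticAt.prod
    ((hs _).comp (((ContinuousLinearMap.snd ℝ (Fin n → ℂ) (Fin n → ℂ)).analyticAt _).comp hV))
    ((hs _).comp (((ContinuousLinearMap.fst ℝ (Fin n → ℂ) (Fin n → ℂ)).analyticAt _).comp hV))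

lemma conjField_add (V W : CField n) : conjField (V + W) = conjField V + conjField W := by
  funext q; ext k <;> simp [conjField, conjVec]

lemma conjField_smul (c : ℂ) (V : CField n) :
    conjField (c • V) = (starRingEnd ℂ c) • conjField V := by
  funext q; ext k <;> simp [conjField, conjVec]

/-- The form `(V, W) ↦ [V, W̄](p) mod Q` on local sections `V` of `B₁` and `W` of `B₂`;
it is linear in `V` and conjugate-linear in `W`. -/
def bracketForm (M : Set (Fin n → ℂ)) (B₁ B₂ : (Fin n → ℂ) → Submodule ℂ (CVec n))
    (Q : Submodule ℂ (CVec n)) (p : Fin n → ℂ) :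
    sections M B₁ p →ₗ[ℂ] sections M B₂ p →ₛₗ[starRingEnd ℂ] (CVec n ⧸ Q) :=
  LinearMap.mk₂'ₛₗ (RingHom.id ℂ) (starRingEnd ℂ)
    (fun V W => Q.mkQ (bracket (V : CField n) (conjField (W : CField n)) p))
    (fun V V' W => by
      rw [Submodule.coe_add, bracket_add_left V.2.1 V'.2.1, map_add])
    (fun c V W => by
      rw [Submodule.coe_smul, bracket_smul_left c V.2.1, map_smul, RingHom.id_apply])
    (fun V W W' => by
      rw [Submodule.coe_add, conjField_add, bracket_antisymm, bracket_add_left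
        (analyticAt_conjField W.2.1) (analyticAt_conjField W'.2.1), neg_add, map_add,
        ← bracket_antisymm, ← bracket_antisymm])
    (fun c V W => by
      rw [Submodule.coe_smul, conjField_smul, bracket_antisymm, bracket_smul_left _
        (analyticAt_conjField W.2.1), ← smul_neg, map_smul, ← bracket_antisymm])

lemma along_sum {f : Fin n → (Fin n → ℂ) → ℂ} {p : Fin n → ℂ} (v : CVec n)
    (hf : ∀ j, DifferentiableAt ℝ (f j) p) :
    along v (fun q => ∑ j, f j q) p = ∑ j, along v (f j) p := by
  simp only [along, dz, dzbar, fderiv_fun_sum fun j _ => hf j, sum_apply]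
  rw [Finset.sum_comm]
  refine Finset.sum_congr rfl fun j _ => ?_
  rw [Finset.sum_add_distrib, ← Finset.mul_sum, ← Finset.mul_sum, ← Finset.sum_div,
    ← Finset.sum_div, Finset.sum_add_distrib, Finset.sum_sub_distrib, Finset.mul_sum]

/-- Leibniz rule at a zero of the first factor. -/
lemma along_mul {f g : (Fin n → ℂ) → ℂ} {p : Fin n → ℂ} (v : CVec n)
    (hf : DifferentiableAt ℝ f p) (hg : DifferentiableAt ℝ g p) (h0 : f p = 0) :
    along v (fun q => f q * g q) p = along v f p * g p := by
  simp only [along, dz, dzbar, fderiv_fun_mul hf hg, h0, Finset.sum_mul]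
  exact Finset.sum_congr rfl fun j _ => by simp; ring

lemma analyticAt_dz {f : (Fin n → ℂ) → ℂ} {p : Fin n → ℂ} (hf : AnalyticAt ℝ f p) (j : Fin n) :
    AnalyticAt ℝ (dz j f) p ∧ AnalyticAt ℝ (dzbar j f) p := by
  have h : ∀ x : Fin n → ℂ, AnalyticAt ℝ (fun q => fderiv ℝ f q x) p := fun x =>
    ((ContinuousLinearMap.apply ℝ ℂ x).analyticAt _).comp hf.fderiv
  exact ⟨((h _).sub (analyticAt_const.mul (h _))).div_const,
    ((h _).add (analyticAt_const.mul (h _))).div_const⟩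

/-- Differentiating, in a tangent direction, a tangent field which vanishes at `p` gives a tangent
vector. -/
lemma along_mem_complexTangent {M : Set (Fin n → ℂ)} {p : Fin n → ℂ} {V : CField n} {w : CVec n}
    (hV : V ∈ sections M (complexTangent M) p) (h0 : V p = 0) (hw : w ∈ complexTangent M p) :
    ((fun k => along w (fun q => (V q).1 k) p, fun k => along w (fun q => (V q).2 k) p) : CVec n) ∈
      complexTangent M p := by
  intro f hf hfM
  have hd1 := fun j => (analyticAt_dz hf j).1
  have hd2 := fun j => (analyticAt_dz hf j).2
  have ha1 : ∀ k, AnalyticAt ℝ (fun q => (V q).1 k) p := fun k =>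
    ((ContinuousLinearMap.proj (R := ℝ) k).comp
      (ContinuousLinearMap.fst ℝ (Fin n → ℂ) (Fin n → ℂ))).analyticAt _ |>.comp hV.1
  have ha2 : ∀ k, AnalyticAt ℝ (fun q => (V q).2 k) p := fun k =>
    ((ContinuousLinearMap.proj (R := ℝ) k).comp
      (ContinuousLinearMap.snd ℝ (Fin n → ℂ) (Fin n → ℂ))).analyticAt _ |>.comp hV.1
  have hg : along w (fun q => along (V q) f q) p = 0 := by
    refine hw _ ?_ ?_
    · exact Finset.analyticAt_fun_sum _ fun j _ =>
        ((ha1 j).mul (hd1 j)).add ((ha2 j).mul (hd2 j))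
    · filter_upwards [hV.2, eventually_eventually_nhdsWithin.2 hfM,
        hf.eventually_analyticAt.filter_mono nhdsWithin_le_nhds] with q h1 h2 h3
      exact h1 f h3 h2
  have e : along w (fun q => along (V q) f q) p =
      along w (fun q => ∑ j, ((V q).1 j * dz j f q + (V q).2 j * dzbar j f q)) p := rfl
  rw [e, along_sum (f := fun j q => (V q).1 j * dz j f q + (V q).2 j * dzbar j f q) w fun j =>
    ((ha1 j).mul (hd1 j)).differentiableAt.add ((ha2 j).mul (hd2 j)).differentiableAt] at hg
  rw [along, ← hg]
  refine Finset.sum_congr rfl fun j _ => ?_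
  rw [along_add (f := fun q => (V q).1 j * dz j f q) (g := fun q => (V q).2 j * dzbar j f q) w
      ((ha1 j).mul (hd1 j)).differentiableAt ((ha2 j).mul (hd2 j)).differentiableAt,
    along_mul w (ha1 j).differentiableAt (hd1 j).differentiableAt (by simp [h0]),
    along_mul w (ha2 j).differentiableAt (hd2 j).differentiableAt (by simp [h0])]

lemma conjVec_mem {M : Set (Fin n → ℂ)} {p : Fin n → ℂ} {v : CVec n}
    (hv : v ∈ complexTangent M p) : conjVec v ∈ complexTangent M p := by
  intro f hf hfM
  have hc : ∀ x, fderiv ℝ (fun q => star (f q)) p x = star (fderiv ℝ f p x) := fun x => by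
    have := ((starL' ℝ (A := ℂ)).toContinuousLinearMap.hasFDerivAt.comp p
      hf.differentiableAt.hasFDerivAt).fderiv
    exact congrArg (fun L => L x) this
  have h := hv (fun q => star (f q))
    (((starL' ℝ (A := ℂ)).toContinuousLinearMap.analyticAt _).comp hf)
    (by filter_upwards [hfM] with q hq; simp [hq])
  have h2 := congrArg star h
  rw [star_zero] at h2
  rw [← h2]
  simp only [along, dz, dzbar, hc, star_sum, conjVec]
  exact Finset.sum_congr rfl fun j _ => by simp [Complex.conj_I]; ring

lemma conjField_mem {M : Set (Fin n → ℂ)} {p : Fin n → ℂ} {V : CField n}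
    (hV : V ∈ sections M (T10 M) p) : conjField V ∈ sections M (T01 M) p := by
  refine ⟨analyticAt_conjField hV.1, ?_⟩
  filter_upwards [hV.2] with q hq
  refine ⟨?_, conjVec_mem hq.2⟩
  have h : (V q).2 = 0 := hq.1
  simp [conjField, conjVec, h]

/-- If `V`, `W` are tangent to `M` and `V(p) = 0`, then `[V, W](p)` is tangent; if moreover `V` is
of type `(1,0)` or of type `(0,1)`, then so is `[V, W](p)`. -/
lemma bracket_mem_of_eq_zero {M : Set (Fin n → ℂ)} {p : Fin n → ℂ} (hp : p ∈ M) {V W : CField n}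
    (hW : W ∈ sections M (complexTangent M) p) (h0 : V p = 0) :
    (V ∈ sections M (T10 M) p → bracket V W p ∈ T10 M p) ∧
      (V ∈ sections M (T01 M) p → bracket V W p ∈ T01 M p) := by
  have hw : W p ∈ complexTangent M p := hW.2.self_of_nhdsWithin hp
  have e : bracket V W p = -((fun k => along (W p) (fun q => (V q).1 k) p,
      fun k => along (W p) (fun q => (V q).2 k) p) : CVec n) := by
    ext k <;> simp [bracket, h0, along]
  rw [e]
  constructor <;> intro hV <;> refine neg_mem ⟨?_, along_mem_complexTangent
    ⟨hV.1, by filter_upwards [hV.2] with q hq using hq.2⟩ h0 hw⟩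
  · refine LinearMap.mem_ker.2 (funext fun k => hw (fun q => (V q).2 k)
      (((ContinuousLinearMap.proj (R := ℝ) k).comp
        (ContinuousLinearMap.snd ℝ (Fin n → ℂ) (Fin n → ℂ))).analyticAt _ |>.comp hV.1) ?_)
    filter_upwards [hV.2] with q hq
    exact congrFun (LinearMap.mem_ker.1 hq.1) k
  · refine LinearMap.mem_ker.2 (funext fun k => hw (fun q => (V q).1 k)
      (((ContinuousLinearMap.proj (R := ℝ) k).comp
        (ContinuousLinearMap.fst ℝ (Fin n → ℂ) (Fin n → ℂ))).analyticAt _ |>.comp hV.1) ?_)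
    filter_upwards [hV.2] with q hq
    exact congrFun (LinearMap.mem_ker.1 hq.1) k

/-- The Levi form of `M` at `p`: the form `(V, W) ↦ √-1 [V, W̄](p) mod T^{1,0}_p M ⊕ T^{0,1}_p M`
on the values at `p` of local sections `V`, `W` of `T^{1,0} M`. It is written on the sections which
extend these values; `leviForm_eq_zero_left` and `leviForm_eq_zero_right` show that only the
values at `p` matter. -/
def leviForm (M : Set (Fin n → ℂ)) (p : Fin n → ℂ) :
    sections M (T10 M) p →ₗ[ℂ] sections M (T10 M) p →ₛₗ[starRingEnd ℂ]
      (CVec n ⧸ (T10 M p ⊔ T01 M p)) :=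
  Complex.I • bracketForm M (T10 M) (T10 M) (T10 M p ⊔ T01 M p) p

lemma leviForm_eq_zero_left {M : Set (Fin n → ℂ)} {p : Fin n → ℂ} (hp : p ∈ M)
    (V W : sections M (T10 M) p) (h0 : (V : CField n) p = 0) : leviForm M p V W = 0 := by
  have hW := conjField_mem W.2
  refine (Submodule.Quotient.mk_eq_zero _).2 (Submodule.smul_mem _ _
    (Submodule.mem_sup_left ?_))
  exact (bracket_mem_of_eq_zero hp
    ⟨hW.1, by filter_upwards [hW.2] with q hq using hq.2⟩ h0).1 V.2

lemma leviForm_eq_zero_right {M : Set (Fin n → ℂ)} {p : Fin n → ℂ} (hp : p ∈ M)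
    (V W : sections M (T10 M) p) (h0 : (W : CField n) p = 0) : leviForm M p V W = 0 := by
  refine (Submodule.Quotient.mk_eq_zero _).2 (Submodule.smul_mem _ _
    (Submodule.mem_sup_right ?_))
  show bracket (V : CField n) (conjField (W : CField n)) p ∈ _
  rw [bracket_antisymm]
  refine neg_mem ((bracket_mem_of_eq_zero hp
    ⟨V.2.1, by filter_upwards [V.2.2] with q hq using hq.2⟩ ?_).2 (conjField_mem W.2))
  ext k <;> simp [conjField, conjVec, h0]

/-- The complex rank of the Levi form of `M` at `p`. -/
def leviRank (M : Set (Fin n → ℂ)) (p : Fin n → ℂ) : ℕ :=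
  Module.finrank ℂ (LinearMap.range (leviForm M p))

/-- `K^{1,0}_p M`, the kernel of the Levi form at `p`: the values at `p` of the sections `V` of
`T^{1,0} M` with `leviForm (V, W) = 0` for all sections `W` of `T^{1,0} M`. -/
def leviKernel (M : Set (Fin n → ℂ)) (p : Fin n → ℂ) : Submodule ℂ (CVec n) :=
  ((LinearMap.ker (leviForm M p)).map (sections M (T10 M) p).subtype).map
    (LinearMap.proj p : CField n →ₗ[ℂ] CVec n)

/-- The Freeman form of `M` at `p`: the form `(V, W) ↦ [V, W̄](p) mod K^{1,0}_p M ⊕ T^{0,1}_p M`,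
written on local sections `V` of `K^{1,0} M` and `W` of `T^{1,0} M` extending the given vectors. -/
def freemanForm (M : Set (Fin n → ℂ)) (p : Fin n → ℂ) :
    sections M (leviKernel M) p →ₗ[ℂ] sections M (T10 M) p →ₛₗ[starRingEnd ℂ]
      (CVec n ⧸ (leviKernel M p ⊔ T01 M p)) :=
  bracketForm M (leviKernel M) (T10 M) (leviKernel M p ⊔ T01 M p) p

/-! ### Local biholomorphisms and products -/

/-- A biholomorphism between two open subsets `h.source`, `h.target` of `ℂⁿ`. -/
def IsBiholomorphism (h : OpenPartialHomeomorph (Fin n → ℂ) (Fin n → ℂ)) : Prop :=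
  AnalyticOnNhd ℂ h h.source ∧ AnalyticOnNhd ℂ h.symm h.target

/-- The product `N × ℂ_{z₂} ⊆ ℂ³` of `N ⊆ ℂ²`, in coordinates `(z₁, z₂, w)` on `ℂ³` and
`(z₁, w)` on `ℂ²`. -/
def prodLine (N : Set (Fin 2 → ℂ)) : Set (Fin 3 → ℂ) := {ζ | ![ζ 0, ζ 2] ∈ N}

/-- Near `p`, `M ⊆ ℂ³` is biholomorphic to (an open piece of) a product `N × ℂ`, where `N ⊆ ℂ²` is
a real-analytic hypersurface. -/
def IsLocallyProductAt (M : Set (Fin 3 → ℂ)) (p : Fin 3 → ℂ) : Prop :=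
  ∃ h : OpenPartialHomeomorph (Fin 3 → ℂ) (Fin 3 → ℂ), IsBiholomorphism h ∧ p ∈ h.source ∧
    ∃ N : Set (Fin 2 → ℂ), IsRealAnalyticHypersurface N ∧
      h '' (M ∩ h.source) = prodLine N ∩ h.target

/-- In suitable holomorphic coordinates `(z₁, z₂, w)` centred at `p`, `M ⊆ ℂ³` is a graph
`v = φ(x₁, y₁, u)`, where `w = u + i v`, with `φ` real-analytic, independent of `z₂`, and
`φ(0) = dφ(0) = 0`. -/
def IsLocallyGraphIndependentOfZ2At (M : Set (Fin 3 → ℂ)) (p : Fin 3 → ℂ) : Prop :=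
  ∃ h : OpenPartialHomeomorph (Fin 3 → ℂ) (Fin 3 → ℂ), IsBiholomorphism h ∧ p ∈ h.source ∧
    h p = 0 ∧ ∃ φ : ℂ × ℝ → ℝ, φ 0 = 0 ∧ fderiv ℝ φ 0 = 0 ∧
      (∀ ζ ∈ h.target, AnalyticAt ℝ φ (ζ 0, (ζ 2).re)) ∧
      h '' (M ∩ h.source) = {ζ ∈ h.target | (ζ 2).im = φ (ζ 0, (ζ 2).re)}

end CRGeom

end

/-! Both directions amount to one question: does the Levi kernel, a line bundle because the rank is
`1`, have near each point a nowhere vanishing section with holomorphic coefficients? In product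
coordinates such a section is `∂/∂z₂`.

Everything is computed by polarization. A real-analytic function of `q` is the restriction to `{(q,
q̄)}` of a holomorphic function of `(z, ζ)` (`exists_complexification`). A vector `(a, b)` of type
`T^{1,0} ⊕ T^{0,1}` then acts by an ordinary complex-linear derivative (`along_eq_fderiv`), and `M`
becomes the diagonal part of the complex hypersurface `R(z, ζ) = 0`, on which holomorphic functions
are determined by their values on `M` (`IsDefiningAt.eventually_eq_zero`). The Levi form becomes the
mixed Hessian of `R` on `T^{1,0} × T^{0,1}` (`IsDefiningAt.leviForm_eq_zero_iff`).

Suppose that the Freeman form vanishes, and normalize a kernel section `K` so that one coefficient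
is `1`. The (1,0)-part of `[K, L̄]` is `-L̄(K)`; it lies in the kernel line and its normalized
coefficient is `0`, so it vanishes: the coefficients of `K` are CR functions. Their polarizations
are constant along the `ζ`-fibres of `{R = 0}`, so they descend to a holomorphic field `k(z)`
tangent to every Segre variety (`IsDefiningAt.exists_holomorphic_extension`). Write `{R = 0}`
through a function `Θ(z, ζ)` that solves for one `ζ`-direction. Then `k` annihilates `Θ(·, ζ)` for
all `ζ`, hence also the `ζ`-derivatives of `Θ`. This gives two first integrals, independent because
the Levi form is nonzero, and with the normalized coordinate they straighten `k` without solving an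
ODE. In these coordinates `{R = 0}` is invariant under `z₂`-translations in `z`, by Hermitian
symmetry also in `ζ`, so `M` is invariant (`IsSegreSolution.exists_straightening`). The real
implicit function theorem on the slice `z₂ = 0` gives the graph, and the graph gives the product.

Conversely, a product carries the holomorphic tangent field `Z = ∂/∂z₂`. It lies in the Levi kernel,
so every kernel section is `ψ Z` along `M`, and the (1,0)-part of `[ψ Z, L̄]` is `-L̄(ψ) Z`, again
in the kernel (`IsDefiningAt.freemanForm_eq_zero`). -/

open Filter Topology
open scoped ContDiff

noncomputable section

namespace CRGeom

variable {n : ℕ}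

/-! ### Polarization: extending real-analytic functions holomorphically from the diagonal. -/

section Complexification

variable {F : Type*} [NormedAddCommGroup F] [NormedSpace ℂ F]

/-- The embedding `q ↦ (q, q̄)` of `ℂⁿ` onto the totally real diagonal of `ℂⁿ × ℂⁿ`. -/
def diag : (Fin n → ℂ) →L[ℝ] CVec n :=
  (ContinuousLinearMap.id ℝ (Fin n → ℂ)).prod
    (starL' ℝ (A := Fin n → ℂ)).toContinuousLinearMap

lemma diag_apply (q : Fin n → ℂ) : diag q = (q, star q) := rfl

@[simp] lemma conjVec_diag (q : Fin n → ℂ) : conjVec (diag q) = diag q := by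
  simp [conjVec, diag_apply]

lemma conjVec_conjVec (v : CVec n) : conjVec (conjVec v) = v := by
  simp [conjVec]

/-- A holomorphic function which vanishes on the diagonal near `diag p` vanishes near `diag p`. -/
lemma eventually_eq_zero_of_diag [CompleteSpace F] {g : CVec n → F} {p : Fin n → ℂ}
    (hg : ∀ᶠ y in 𝓝 (diag p), DifferentiableAt ℂ g y) (h0 : ∀ᶠ q in 𝓝 p, g (diag q) = 0) :
    ∀ᶠ y in 𝓝 (diag p), g y = 0 := by
  obtain ⟨ε, hε, hgε⟩ := Metric.eventually_nhds_iff_ball.1 hg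
  obtain ⟨δ, hδ, h0δ⟩ := Metric.eventually_nhds_iff_ball.1 h0
  -- a point `y` is `diag q + i diag v`
  let q : CVec n → (Fin n → ℂ) := fun y => (2⁻¹ : ℂ) • (y.1 + star y.2)
  let v : CVec n → (Fin n → ℂ) := fun y => (2 * Complex.I)⁻¹ • (y.1 - star y.2)
  have hqv : ∀ y, y = diag (q y) + Complex.I • diag (v y) := fun y => by
    ext k
    · simp [q, v, diag_apply]; field_simp; ring_nf; simp; ring
    · simp [q, v, diag_apply]; field_simp; ring_nf; simp; ring
  have hq : ContinuousAt q (diag p) := by fun_prop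
  have hv : ContinuousAt v (diag p) := by fun_prop
  have hq0 : q (diag p) = p := by ext k; simp [q, diag_apply]; ring
  have hv0 : v (diag p) = 0 := by ext k; simp [v, diag_apply]
  have e1 : ∀ᶠ y in 𝓝 (diag p), ‖diag (q y) - diag p‖ < ε / 3 := by
    have : ContinuousAt (fun y => ‖diag (q y) - diag p‖) (diag p) := by fun_prop
    exact this.eventually_lt continuousAt_const (by simp [hq0]; positivity)
  have e2 : ∀ᶠ y in 𝓝 (diag p), ‖diag (v y)‖ < ε / 3 := by
    have : ContinuousAt (fun y => ‖diag (v y)‖) (diag p) := by fun_prop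
    exact this.eventually_lt continuousAt_const (by simp [hv0]; positivity)
  have e3 : ∀ᶠ y in 𝓝 (diag p), q y ∈ Metric.ball p δ :=
    hq.eventually_mem (by rw [hq0]; exact Metric.ball_mem_nhds p hδ)
  filter_upwards [e1, e2, e3] with y h1 h2 h3
  -- Restrict `g` to the complex line through `diag (q y)` in the direction `diag (v y)`. Real `s`
  -- near `0` stay on the diagonal, so the one-variable identity theorem applies; the disc of radius
  -- `2` contains `s = i`, which is the point `y`.
  set φ : ℂ → F := fun s => g (diag (q y) + s • diag (v y)) with hφ
  have hmem : ∀ s ∈ Metric.ball (0 : ℂ) 2, diag (q y) + s • diag (v y) ∈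
      Metric.ball (diag p) ε := fun s hs => by
    rw [mem_ball_zero_iff] at hs
    rw [mem_ball_iff_norm, add_sub_right_comm]
    calc _ ≤ ‖diag (q y) - diag p‖ + ‖s • diag (v y)‖ := norm_add_le _ _
      _ = ‖diag (q y) - diag p‖ + ‖s‖ * ‖diag (v y)‖ := by rw [norm_smul]
      _ ≤ ‖diag (q y) - diag p‖ + 2 * ‖diag (v y)‖ := by gcongr
      _ < ε := by linarith
  have hφd : DifferentiableOn ℂ φ (Metric.ball 0 2) := fun s hs =>
    ((hgε _ (hmem s hs)).comp s (f := fun s : ℂ => diag (q y) + s • diag (v y))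
      (by fun_prop)).differentiableWithinAt
  have hreal : ∀ᶠ t : ℝ in 𝓝 0, φ t = 0 := by
    have hc : ContinuousAt (fun t : ℝ => q y + t • v y) 0 := by fun_prop
    filter_upwards [hc.eventually_mem (s := Metric.ball p δ)
      (by simpa using Metric.isOpen_ball.mem_nhds h3)] with t ht
    rw [← h0δ _ ht, map_add, diag.map_smul t, ← Complex.coe_smul]
  have hfreq : ∃ᶠ s in 𝓝[≠] (0 : ℂ), φ s = 0 := by
    have ht : Tendsto (fun t : ℝ => (t : ℂ)) (𝓝[≠] 0) (𝓝[≠] 0) :=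
      tendsto_nhdsWithin_of_tendsto_nhds_of_eventually_within _
        (tendsto_nhdsWithin_of_tendsto_nhds (Complex.continuous_ofReal.tendsto' 0 0 (by simp)))
        (eventually_nhdsWithin_of_forall fun t ht => by simpa using ht)
    exact ht.frequently (hreal.filter_mono nhdsWithin_le_nhds).frequently
  have := (hφd.analyticOnNhd Metric.isOpen_ball).eqOn_zero_of_preconnected_of_frequently_eq_zero
    (convex_ball _ _).isPreconnected (Metric.mem_ball_self two_pos) hfreq
    (x := Complex.I) (by simp)
  rw [hqv y]
  exact this

/-- The complex multilinear extension to `G` of a real multilinear map on `E`, where `b` is a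
spanning family of `E` and `c` extends the corresponding coordinates to `G`. -/
def extendMultilinear {ι E G : Type*} [Fintype ι] [NormedAddCommGroup E] [NormedSpace ℝ E]
    [NormedAddCommGroup G] [NormedSpace ℂ G] [NormedSpace ℝ F] (b : ι → E) (c : ι → G →L[ℂ] ℂ)
    (k : ℕ) (p : E [×k]→L[ℝ] F) : G [×k]→L[ℂ] F :=
  ∑ j : Fin k → ι, ((ContinuousMultilinearMap.mkPiAlgebra ℂ (Fin k) ℂ).compContinuousLinearMap
    fun i => c (j i)).smulRight (p fun i => b (j i))

variable {ι E G : Type*} [Fintype ι] [NormedAddCommGroup E] [NormedSpace ℝ E]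
    [NormedAddCommGroup G] [NormedSpace ℂ G] [NormedSpace ℝ F]

lemma extendMultilinear_apply (b : ι → E) (c : ι → G →L[ℂ] ℂ)
    (k : ℕ) (p : E [×k]→L[ℝ] F) (y : Fin k → G) :
    extendMultilinear b c k p y = ∑ j : Fin k → ι, (∏ i, c (j i) (y i)) • p fun i => b (j i) := by
  simp [extendMultilinear]

/-- There are `(card ι) ^ k` terms, each at most `C ^ k * ‖p‖`. The growth is only geometric in `k`,
so extending a convergent power series term by term keeps a positive radius. -/
lemma norm_extendMultilinear_le (b : ι → E) (c : ι → G →L[ℂ] ℂ) {C : ℝ}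
    (hC0 : 0 ≤ C) (hC : ∀ j, ‖c j‖ * ‖b j‖ ≤ C) (k : ℕ) (p : E [×k]→L[ℝ] F) :
    ‖extendMultilinear b c k p‖ ≤ (Fintype.card ι * C) ^ k * ‖p‖ := by
  refine ContinuousMultilinearMap.opNorm_le_bound (by positivity) fun y => ?_
  rw [extendMultilinear_apply]
  have h1 : ∀ j : Fin k → ι, ‖(∏ i, c (j i) (y i)) • p fun i => b (j i)‖ ≤
      C ^ k * ‖p‖ * ∏ i, ‖y i‖ := fun j => by
    rw [norm_smul, norm_prod]
    calc (∏ i, ‖c (j i) (y i)‖) * ‖p fun i => b (j i)‖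
        ≤ (∏ i, ‖c (j i)‖ * ‖y i‖) * (‖p‖ * ∏ i, ‖b (j i)‖) := by
          gcongr with i
          · exact (c (j i)).le_opNorm _
          · exact p.le_opNorm _
      _ = (∏ i, ‖c (j i)‖ * ‖b (j i)‖) * (‖p‖ * ∏ i, ‖y i‖) := by
          simp only [Finset.prod_mul_distrib]; ring
      _ ≤ (∏ _i : Fin k, C) * (‖p‖ * ∏ i, ‖y i‖) := by
          gcongr with i
          exact hC _
      _ = _ := by simp; ring
  calc _ ≤ ∑ j : Fin k → ι, C ^ k * ‖p‖ * ∏ i, ‖y i‖ := norm_sum_le_of_le _ fun j _ => h1 j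
    _ = _ := by simp; ring

lemma extendMultilinear_apply_real [IsScalarTower ℝ ℂ F] {b : ι → E} {c : ι → G →L[ℂ] ℂ}
    {x : ι → E → ℝ} {J : E → G} (hb : ∀ q, q = ∑ j, x j q • b j) (hc : ∀ j q, c j (J q) = x j q)
    (k : ℕ) (p : E [×k]→L[ℝ] F) (y : Fin k → E) :
    extendMultilinear b c k p (fun i => J (y i)) = p y := by
  classical
  have h : y = fun i => ∑ j, x j (y i) • b j := funext fun i => hb (y i)
  conv_rhs => rw [h, p.map_sum]
  rw [extendMultilinear_apply]
  refine Finset.sum_congr rfl fun j _ => ?_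
  rw [p.map_smul_univ]
  simp only [hc, ← Complex.ofReal_prod]
  exact algebraMap_smul ℂ (∏ i, x (j i) (y i)) _

/-- Each homogeneous term of the Taylor series extends to a complex multilinear map that agrees with
it on the image of `J`; the extended series still converges near `J p`. -/
lemma exists_analyticAt_extension [CompleteSpace F] [IsScalarTower ℝ ℂ F] {b : ι → E}
    {c : ι → G →L[ℂ] ℂ} {x : ι → E → ℝ} [NormedSpace ℝ G] {J : E →L[ℝ] G}
    (hb : ∀ q, q = ∑ j, x j q • b j)
    (hc : ∀ j q, c j (J q) = x j q) {f : E → F} {p : E} (hf : AnalyticAt ℝ f p) :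
    ∃ g : G → F, AnalyticAt ℂ g (J p) ∧ ∀ᶠ q in 𝓝 p, g (J q) = f q := by
  obtain ⟨s, hs⟩ := hf
  set P : FormalMultilinearSeries ℂ G F := fun k => extendMultilinear b c k (s k)
  set C : ℝ := ∑ j, ‖c j‖ * ‖b j‖ with hCdef
  have hC0 : 0 ≤ C := by positivity
  have hC : ∀ j, ‖c j‖ * ‖b j‖ ≤ C := fun j =>
    Finset.single_le_sum (f := fun j => ‖c j‖ * ‖b j‖) (fun _ _ => by positivity)
      (Finset.mem_univ j)
  obtain ⟨A, r, hA, hr, hAr⟩ := s.le_mul_pow_of_radius_pos hs.radius_pos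
  -- `B⁻¹` serves as a lower bound for the radius; the summand `1` keeps `B` positive even if the
  -- other factor vanishes.
  set B : ℝ := Fintype.card ι * C * r + 1
  have hB : 0 < B := by positivity
  have hP : 0 < P.radius := by
    refine lt_of_lt_of_le ?_ (P.le_radius_of_bound A (r := Real.toNNReal B⁻¹) fun k => ?_)
    · simpa using hB
    · have h1 : Fintype.card ι * C * r * B⁻¹ ≤ 1 := by
        rw [← div_eq_mul_inv, div_le_one hB]
        simp [B]
      rw [Real.coe_toNNReal _ (by positivity)]
      calc ‖P k‖ * (B⁻¹) ^ k ≤ ((Fintype.card ι * C) ^ k * (A * r ^ k)) * (B⁻¹) ^ k := by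
            gcongr
            exact (norm_extendMultilinear_le b c hC0 hC k (s k)).trans (by gcongr; exact hAr k)
        _ = A * (Fintype.card ι * C * r * B⁻¹) ^ k := by simp only [mul_pow]; ring
        _ ≤ A * 1 := by
            gcongr
            exact pow_le_one₀ (by positivity) h1
        _ = A := mul_one A
  have hPs := P.hasFPowerSeriesOnBall hP
  refine ⟨fun y => P.sum (y - J p), ?_, ?_⟩
  · exact hPs.analyticAt.comp_of_eq (by fun_prop) (sub_self _)
  · filter_upwards [hs.eventually_hasSum_sub] with q hq
    have : ∀ k, P k (fun _ => J q - J p) = s k fun _ => q - p := fun k => by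
      simp only [P, ← map_sub]
      exact extendMultilinear_apply_real hb hc k (s k) fun _ => q - p
    simp only [FormalMultilinearSeries.sum, this]
    exact hq.tsum_eq

/-- A real-analytic function on `ℂⁿ` is the restriction to the diagonal `{(q, q̄)}` of a holomorphic
function on `ℂⁿ × ℂⁿ`. -/
lemma exists_complexification [CompleteSpace F] [IsScalarTower ℝ ℂ F] {f : (Fin n → ℂ) → F}
    {p : Fin n → ℂ} (hf : AnalyticAt ℝ f p) :
    ∃ g : CVec n → F, AnalyticAt ℂ g (diag p) ∧ ∀ᶠ q in 𝓝 p, g (diag q) = f q := by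
  let pr1 : Fin n → CVec n →L[ℂ] ℂ := fun j =>
    (ContinuousLinearMap.proj (R := ℂ) j).comp (ContinuousLinearMap.fst ℂ _ _)
  let pr2 : Fin n → CVec n →L[ℂ] ℂ := fun j =>
    (ContinuousLinearMap.proj (R := ℂ) j).comp (ContinuousLinearMap.snd ℂ _ _)
  -- The real coordinates `x_j`, `y_j` extend to the complex-linear forms `(z_j + ζ_j) / 2` and
  -- `(z_j - ζ_j) / 2i`.
  refine exists_analyticAt_extension (ι := Fin n ⊕ Fin n)
    (b := Sum.elim (fun j => Pi.single j 1) fun j => Pi.single j Complex.I)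
    (c := Sum.elim (fun j => (2⁻¹ : ℂ) • (pr1 j + pr2 j))
      fun j => (2 * Complex.I)⁻¹ • (pr1 j - pr2 j))
    (x := Sum.elim (fun j q => (q j).re) fun j q => (q j).im) (fun q => ?_) (fun j q => ?_) hf
  · ext k
    simp [Finset.sum_apply, Pi.single_apply, Complex.re_add_im]
  · rcases j with j | j
    · simp [pr1, pr2, diag_apply, Complex.ext_iff]
      ring
    · simp [pr1, pr2, diag_apply, Complex.ext_iff]
      ring

end Complexification
end CRGeom

namespace CRGeom

variable {n : ℕ}

/-! ### Derivatives along complex vectors through complexifications -/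

lemma exists_eq_diag_add (v : CVec n) : ∃ x y, v = diag x + Complex.I • diag y := by
  refine ⟨(2⁻¹ : ℂ) • (v.1 + star v.2), (2 * Complex.I)⁻¹ • (v.1 - star v.2), ?_⟩
  ext k
  · simp [diag_apply]; field_simp; ring_nf; simp; ring
  · simp [diag_apply]; field_simp; ring_nf; simp; ring

/-- The diagonal is a totally real subspace of maximal dimension, so it spans over `ℂ`. -/
lemma clm_ext_diag {F : Type*} [NormedAddCommGroup F] [NormedSpace ℂ F] {A B : CVec n →L[ℂ] F}
    (h : ∀ x, A (diag x) = B (diag x)) : A = B := by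
  refine ContinuousLinearMap.ext fun v => ?_
  obtain ⟨x, y, rfl⟩ := exists_eq_diag_add v
  simp [h]

lemma hasFDerivAt_comp_diag {F : Type*} [NormedAddCommGroup F] [NormedSpace ℂ F] [NormedSpace ℝ F]
    [IsScalarTower ℝ ℂ F] {g : CVec n → F} {f : (Fin n → ℂ) → F}
    {q : Fin n → ℂ} (hg : DifferentiableAt ℂ g (diag q)) (hfg : ∀ᶠ x in 𝓝 q, g (diag x) = f x) :
    HasFDerivAt f (((fderiv ℂ g (diag q)).restrictScalars ℝ).comp diag) q :=
  ((hg.hasFDerivAt.restrictScalars ℝ).comp q diag.hasFDerivAt).congr_of_eventuallyEq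
    (by filter_upwards [hfg] with x hx using hx.symm)

/-- The Wirtinger derivatives `∂/∂z_j` and `∂/∂z̄_j` of `f` are the partial derivatives of `g` in
`z_j` and `ζ_j`. From here on, derivatives along complex vectors are values of one complex-linear
map. -/
lemma along_eq_fderiv {g : CVec n → ℂ} {f : (Fin n → ℂ) → ℂ} {q : Fin n → ℂ}
    (hg : DifferentiableAt ℂ g (diag q)) (hfg : ∀ᶠ x in 𝓝 q, g (diag x) = f x) (v : CVec n) :
    along v f q = fderiv ℂ g (diag q) v := by
  set A := fderiv ℂ g (diag q) with hA
  have hf : ∀ x, fderiv ℝ f q x = A (diag x) := fun x => by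
    rw [(hasFDerivAt_comp_diag hg hfg).fderiv]; rfl
  have e1 : ∀ j, diag (Pi.single j (1 : ℂ) : Fin n → ℂ) =
      (Pi.single j 1, 0) + (0, Pi.single j 1) := fun j => by
    ext k
    · simp [diag_apply]
    · by_cases h : k = j
      · subst h; simp [diag_apply]
      · simp [diag_apply, h]
  have e2 : ∀ j, diag (Pi.single j Complex.I : Fin n → ℂ) =
      Complex.I • (Pi.single j 1, 0) - Complex.I • (0, Pi.single j 1) := fun j => by
    ext k <;> by_cases h : k = j
    · subst h; simp [diag_apply]
    · simp [diag_apply, h]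
    · subst h; simp [diag_apply]
    · simp [diag_apply, h]
  have h1 : ∀ j, dz j f q = A (Pi.single j 1, 0) := fun j => by
    rw [dz, hf, hf, e1, e2, map_add, map_sub, map_smul, map_smul, smul_eq_mul, smul_eq_mul]
    linear_combination (-(A (Pi.single j 1, 0)) + A (0, Pi.single j 1)) / 2 * Complex.I_mul_I
  have h2 : ∀ j, dzbar j f q = A (0, Pi.single j 1) := fun j => by
    rw [dzbar, hf, hf, e1, e2, map_add, map_sub, map_smul, map_smul, smul_eq_mul, smul_eq_mul]
    linear_combination ((A (Pi.single j 1, 0)) - A (0, Pi.single j 1)) / 2 * Complex.I_mul_I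
  have hv : v = ∑ j, (v.1 j • (Pi.single j 1, 0) + v.2 j • (0, Pi.single j 1)) := by
    ext k <;> simp [Finset.sum_apply, Prod.fst_sum, Prod.snd_sum, Pi.single_apply]
  conv_rhs => rw [hv]
  simp only [along, h1, h2, map_sum, map_add, map_smul, smul_eq_mul]

/-- `R` is the complexification, near `diag p`, of a real-analytic defining function of `M`
near `p`. -/
structure IsDefiningAt (M : Set (Fin n → ℂ)) (R : CVec n → ℂ) (p : Fin n → ℂ) : Prop where
  analyticAt : AnalyticAt ℂ R (diag p)
  im_eq_zero : ∀ᶠ q in 𝓝 p, (R (diag q)).im = 0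
  mem_iff : ∀ᶠ q in 𝓝 p, q ∈ M ↔ R (diag q) = 0
  fderiv_ne_zero : fderiv ℂ R (diag p) ≠ 0

lemma IsRealAnalyticHypersurface.exists_isDefiningAt {M : Set (Fin n → ℂ)}
    (hM : IsRealAnalyticHypersurface M) {p : Fin n → ℂ} (hp : p ∈ M) :
    ∃ R, IsDefiningAt M R p := by
  obtain ⟨U, hU, hpU, r, hr, hrM, hr'⟩ := hM p hp
  have hrC : AnalyticAt ℝ (fun q => (r q : ℂ)) p :=
    (Complex.ofRealCLM.analyticAt _).comp (hr p hpU)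
  obtain ⟨R, hR, hRr⟩ := exists_complexification hrC
  refine ⟨R, hR, ?_, ?_, fun h => hr' p hpU ?_⟩
  · filter_upwards [hRr] with q hq
    simp [hq]
  · filter_upwards [hRr, hU.mem_nhds hpU] with q hq hqU
    rw [hq, hrM q hqU]
    simp
  · have h1 := (hasFDerivAt_comp_diag hR.differentiableAt hRr).unique
      (Complex.ofRealCLM.hasFDerivAt.comp p (hr p hpU).differentiableAt.hasFDerivAt)
    ext x
    have := congrArg (fun A => A x) h1
    simpa [h] using this.symm

/-! ### Complexified defining functions and the tangent spaces of `M`. -/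

variable {M : Set (Fin n → ℂ)} {R : CVec n → ℂ} {p : Fin n → ℂ}

lemma IsDefiningAt.eventually (h : IsDefiningAt M R p) : ∀ᶠ q in 𝓝 p, IsDefiningAt M R q := by
  have hc : ContinuousAt (fun q : Fin n → ℂ => diag q) p := by fun_prop
  have hc' : ContinuousAt (fun q : Fin n → ℂ => fderiv ℂ R (diag q)) p :=
    ContinuousAt.comp (f := fun q : Fin n → ℂ => diag q) h.analyticAt.fderiv.continuousAt hc
  filter_upwards [hc.eventually h.analyticAt.eventually_analyticAt,
    eventually_eventually_nhds.2 h.im_eq_zero, eventually_eventually_nhds.2 h.mem_iff,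
    hc'.eventually_ne h.fderiv_ne_zero] with q h1 h2 h3 h4 using ⟨h1, h2, h3, h4⟩

lemma IsDefiningAt.fderiv_diag_im (h : IsDefiningAt M R p) (x : Fin n → ℂ) :
    (fderiv ℂ R (diag p) (diag x)).im = 0 := by
  have h1 := hasFDerivAt_comp_diag h.analyticAt.differentiableAt
    (f := fun q => R (diag q)) (Eventually.of_forall fun _ => rfl)
  have h2 : HasFDerivAt (fun q => (R (diag q)).im) _ p := Complex.imCLM.hasFDerivAt.comp p h1
  have h3 : HasFDerivAt (fun q => (R (diag q)).im) (0 : (Fin n → ℂ) →L[ℝ] ℝ) p :=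
    (hasFDerivAt_const (0 : ℝ) p).congr_of_eventuallyEq h.im_eq_zero
  exact congrArg (fun A => A x) (h2.unique h3)

/-- `R` is real on the diagonal, so its differential is the complexification of a real form, and
`conjVec` is the conjugation that fixes the diagonal. -/
lemma IsDefiningAt.fderiv_conjVec (h : IsDefiningAt M R p) (v : CVec n) :
    fderiv ℂ R (diag p) (conjVec v) = star (fderiv ℂ R (diag p) v) := by
  obtain ⟨x, y, rfl⟩ := exists_eq_diag_add v
  have e : conjVec (diag x + Complex.I • diag y) = diag x - Complex.I • diag y := by
    ext k <;> simp [conjVec, diag_apply] <;> ring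
  have hx := Complex.conj_eq_iff_im.2 (h.fderiv_diag_im x)
  have hy := Complex.conj_eq_iff_im.2 (h.fderiv_diag_im y)
  rw [e, map_sub, map_add, map_smul, star_add, smul_eq_mul, star_mul']
  simp only [RCLike.star_def, hx, hy, Complex.conj_I]
  ring

lemma IsDefiningAt.exists_diag (h : IsDefiningAt M R p) :
    ∃ e, fderiv ℂ R (diag p) (diag e) = 1 := by
  by_contra! hc
  refine h.fderiv_ne_zero (clm_ext_diag fun x => ?_)
  by_contra hx
  set t := fderiv ℂ R (diag p) (diag x) with ht
  have hre : (t.re : ℂ) = t := Complex.ext (by simp) (by simp [h.fderiv_diag_im x, ht])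
  refine hc ((t.re)⁻¹ • x) ?_
  rw [diag.map_smul, ← Complex.coe_smul, map_smul, ← ht, smul_eq_mul, Complex.ofReal_inv, hre]
  exact inv_mul_cancel₀ hx

/-- Every real vector is a (1,0)-vector plus its conjugate, so a real form that kills all
(1,0)-vectors is zero. -/
lemma IsDefiningAt.exists_fst (h : IsDefiningAt M R p) :
    ∃ e, fderiv ℂ R (diag p) (e, 0) ≠ 0 := by
  obtain ⟨e, he⟩ := h.exists_diag
  refine ⟨e, fun h0 => ?_⟩
  have h1 := h.fderiv_conjVec (e, 0)
  have h2 : diag e = (e, 0) + conjVec (e, 0) := by simp [conjVec, diag_apply]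
  rw [h2, map_add, h1, h0] at he
  simp at he

lemma IsDefiningAt.exists_snd (h : IsDefiningAt M R p) :
    ∃ e, fderiv ℂ R (diag p) (0, e) ≠ 0 := by
  obtain ⟨e, he⟩ := h.exists_fst
  refine ⟨star e, ?_⟩
  have h1 := h.fderiv_conjVec (e, 0)
  simp only [conjVec, star_zero] at h1
  rw [h1]
  simpa using he

/-- A real function that vanishes on `M` has a differential proportional to that of a
defining function. -/
lemma IsDefiningAt.exists_smul_real (h : IsDefiningAt M R p) (hp : p ∈ M)
    {u : (Fin n → ℂ) → ℝ} (hu : AnalyticAt ℝ u p) (h0 : ∀ᶠ q in 𝓝[M] p, u q = 0) :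
    ∃ c : ℝ, ∀ x, (fderiv ℝ u p x : ℂ) = c * fderiv ℂ R (diag p) (diag x) := by
  set r : (Fin n → ℂ) → ℝ := fun q => (R (diag q)).re with hr
  have hRd : AnalyticAt ℝ (fun q => R (diag q)) p :=
    AnalyticAt.comp (g := R) (f := diag) (h.analyticAt.restrictScalars (𝕜 := ℝ))
      (diag.analyticAt p)
  have hra : AnalyticAt ℝ r p := (Complex.reCLM.analyticAt _).comp hRd
  have hr' : ∀ x, (fderiv ℝ r p x : ℂ) = fderiv ℂ R (diag p) (diag x) := fun x => by
    have h1 := hasFDerivAt_comp_diag h.analyticAt.differentiableAt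
      (f := fun q => R (diag q)) (Eventually.of_forall fun _ => rfl)
    have h2 : HasFDerivAt r _ p := Complex.reCLM.hasFDerivAt.comp p h1
    rw [h2.fderiv]
    exact Complex.ext (by simp) (by simp [h.fderiv_diag_im x])
  have hrM : ∀ᶠ q in 𝓝 p, r q = r p → u q = 0 := by
    have hpr : r p = 0 := by simp [hr, h.mem_iff.self_of_nhds.1 hp]
    filter_upwards [h.mem_iff, h.im_eq_zero, eventually_nhdsWithin_iff.1 h0] with q h1 h2 h3 h4
    exact h3 (h1.2 (Complex.ext (h4.trans hpr) h2))
  have hup : u p = 0 := hrM.self_of_nhds rfl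
  -- Since `u` vanishes on the level set of `r` through `p`, the point `p` is trivially a
  -- constrained extremum, and Lagrange multipliers give a linear relation between `du` and `dr`. As
  -- `dr ≠ 0`, the coefficient of `du` is nonzero.
  have hextr : IsLocalExtrOn u {x | r x = r p} p := Or.inl (by
    change ∀ᶠ q in 𝓝[{x | r x = r p}] p, u p ≤ u q
    rw [eventually_nhdsWithin_iff]
    filter_upwards [hrM] with q h1 h2
    rw [hup, h1 h2])
  obtain ⟨a, b, hab, hsum⟩ := hextr.exists_multipliers_of_hasStrictFDerivAt_1d
    hra.hasStrictFDerivAt hu.hasStrictFDerivAt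
  have hb : b ≠ 0 := by
    rintro rfl
    obtain ⟨e, he⟩ := h.exists_diag
    have h1 := congrArg (fun A => A e) hsum
    have h2 : fderiv ℝ r p e = 1 := by exact_mod_cast (hr' e).trans he
    simp [h2] at h1
    simp [h1] at hab
  refine ⟨-(a / b), fun x => ?_⟩
  have h1 : a * fderiv ℝ r p x + b * fderiv ℝ u p x = 0 := congrArg (fun A => A x) hsum
  have h2 : fderiv ℝ u p x = -(a / b) * fderiv ℝ r p x := by
    field_simp
    linarith
  rw [h2, ← hr']
  push_cast
  ring

/-- One germ suffices: if `f` vanishes on `M`, its real and imaginary parts have differentials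
proportional to that of the defining function, so the differential of the complexification of `f` is
a complex multiple of that of `R`. -/
lemma IsDefiningAt.mem_complexTangent (h : IsDefiningAt M R p) (hp : p ∈ M) {v : CVec n} :
    v ∈ complexTangent M p ↔ fderiv ℂ R (diag p) v = 0 := by
  have hRd : AnalyticAt ℝ (fun q => R (diag q)) p :=
    AnalyticAt.comp (g := R) (f := diag) (h.analyticAt.restrictScalars (𝕜 := ℝ))
      (diag.analyticAt p)
  constructor
  · intro hv
    rw [← along_eq_fderiv h.analyticAt.differentiableAt (f := fun q => R (diag q))
      (Eventually.of_forall fun _ => rfl)]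
    refine hv _ hRd (eventually_nhdsWithin_iff.2 ?_)
    filter_upwards [h.mem_iff] with q h1 h2 using h1.1 h2
  · intro hv f hf hf0
    obtain ⟨c, hc⟩ := h.exists_smul_real hp (u := fun q => (f q).re)
      ((Complex.reCLM.analyticAt _).comp hf) (by filter_upwards [hf0] with q hq; simp [hq])
    obtain ⟨d, hd⟩ := h.exists_smul_real hp (u := fun q => (f q).im)
      ((Complex.imCLM.analyticAt _).comp hf) (by filter_upwards [hf0] with q hq; simp [hq])
    obtain ⟨g, hg, hgf⟩ := exists_complexification hf
    have hf' := hf.differentiableAt.hasFDerivAt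
    have h1 : HasFDerivAt (fun q => (f q).re) _ p := Complex.reCLM.hasFDerivAt.comp p hf'
    have h2 : HasFDerivAt (fun q => (f q).im) _ p := Complex.imCLM.hasFDerivAt.comp p hf'
    have h3 : fderiv ℂ g (diag p) = (c + d * Complex.I : ℂ) • fderiv ℂ R (diag p) :=
      clm_ext_diag fun x => by
        have e1 := hc x
        have e2 := hd x
        rw [h1.fderiv] at e1
        rw [h2.fderiv] at e2
        have e3 := congrArg (fun A => A x)
          ((hasFDerivAt_comp_diag hg.differentiableAt hgf).unique hf')
        simp only [ContinuousLinearMap.comp_apply, ContinuousLinearMap.coe_restrictScalars'] at e3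
        rw [e3, ← Complex.re_add_im (fderiv ℝ f p x)]
        simp only [ContinuousLinearMap.comp_apply, Complex.reCLM_apply, Complex.imCLM_apply]
          at e1 e2
        rw [e1, e2]
        simp
        ring
    rw [along_eq_fderiv hg.differentiableAt hgf, h3]
    simp [hv]

end CRGeom

namespace CRGeom

variable {n : ℕ}

lemma analyticAt_clm_apply {𝕜 X A B : Type*} [RCLike 𝕜] [NormedAddCommGroup X] [NormedSpace 𝕜 X]
    [NormedAddCommGroup A] [NormedSpace 𝕜 A] [NormedAddCommGroup B] [NormedSpace 𝕜 B]
    {c : X → A →L[𝕜] B} {v : X → A} {x : X}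
    (hc : AnalyticAt 𝕜 c x) (hv : AnalyticAt 𝕜 v x) : AnalyticAt 𝕜 (fun y => c y (v y)) x :=
  AnalyticAt.comp (g := fun z : (A →L[𝕜] B) × A => z.1 z.2) (f := fun y => (c y, v y))
    ((ContinuousLinearMap.id 𝕜 (A →L[𝕜] B)).analyticAt_bilinear _) (hc.prod hv)

/-! ### The Levi form in terms of a complexified defining function -/

variable {M : Set (Fin n → ℂ)} {R : CVec n → ℂ} {p : Fin n → ℂ}

lemma along_fst_eq {V : CField n} {g : CVec n → CVec n} (hg : DifferentiableAt ℂ g (diag p))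
    (hgV : ∀ᶠ q in 𝓝 p, g (diag q) = V q) (w : CVec n) (k : Fin n) :
    along w (fun q => (V q).1 k) p = (fderiv ℂ g (diag p) w).1 k := by
  let L : CVec n →L[ℂ] ℂ :=
    (ContinuousLinearMap.proj (R := ℂ) k).comp (ContinuousLinearMap.fst ℂ _ _)
  have h1 : HasFDerivAt (fun y => (g y).1 k) _ (diag p) :=
    L.hasFDerivAt.comp (diag p) hg.hasFDerivAt
  rw [along_eq_fderiv h1.differentiableAt, h1.fderiv]
  · rfl
  · filter_upwards [hgV] with q hq
    rw [hq]

lemma along_snd_eq {V : CField n} {g : CVec n → CVec n} (hg : DifferentiableAt ℂ g (diag p))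
    (hgV : ∀ᶠ q in 𝓝 p, g (diag q) = V q) (w : CVec n) (k : Fin n) :
    along w (fun q => (V q).2 k) p = (fderiv ℂ g (diag p) w).2 k := by
  let L : CVec n →L[ℂ] ℂ :=
    (ContinuousLinearMap.proj (R := ℂ) k).comp (ContinuousLinearMap.snd ℂ _ _)
  have h1 : HasFDerivAt (fun y => (g y).2 k) _ (diag p) :=
    L.hasFDerivAt.comp (diag p) hg.hasFDerivAt
  rw [along_eq_fderiv h1.differentiableAt, h1.fderiv]
  · rfl
  · filter_upwards [hgV] with q hq
    rw [hq]

lemma bracket_eq {V W : CField n} {g g' : CVec n → CVec n}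
    (hg : DifferentiableAt ℂ g (diag p)) (hgV : ∀ᶠ q in 𝓝 p, g (diag q) = V q)
    (hg' : DifferentiableAt ℂ g' (diag p)) (hgW : ∀ᶠ q in 𝓝 p, g' (diag q) = W q) :
    bracket V W p = fderiv ℂ g' (diag p) (V p) - fderiv ℂ g (diag p) (W p) := by
  ext k
  · simp [bracket, along_fst_eq hg hgV, along_fst_eq hg' hgW]
  · simp [bracket, along_snd_eq hg hgV, along_snd_eq hg' hgW]

lemma sections_T10_le {V : CField n} (hV : V ∈ sections M (T10 M) p) :
    V ∈ sections M (complexTangent M) p :=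
  ⟨hV.1, by filter_upwards [hV.2] with q hq using hq.2⟩

lemma sections_T01_le {V : CField n} (hV : V ∈ sections M (T01 M) p) :
    V ∈ sections M (complexTangent M) p :=
  ⟨hV.1, by filter_upwards [hV.2] with q hq using hq.2⟩

lemma analyticAt_fst {V : CField n} (hV : AnalyticAt ℝ V p) (k : Fin n) :
    AnalyticAt ℝ (fun q => (V q).1 k) p :=
  ((ContinuousLinearMap.proj (R := ℝ) k).comp
    (ContinuousLinearMap.fst ℝ (Fin n → ℂ) (Fin n → ℂ))).analyticAt _ |>.comp hV

lemma analyticAt_snd {V : CField n} (hV : AnalyticAt ℝ V p) (k : Fin n) :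
    AnalyticAt ℝ (fun q => (V q).2 k) p :=
  ((ContinuousLinearMap.proj (R := ℝ) k).comp
    (ContinuousLinearMap.snd ℝ (Fin n → ℂ) (Fin n → ℂ))).analyticAt _ |>.comp hV

/-- The `∂/∂z̄` coefficients of `V` vanish on `M`, hence so do their tangential derivatives; off `M`
nothing is known about them. -/
lemma fderiv_snd_eq_zero {V : CField n} {g : CVec n → CVec n}
    (hg : DifferentiableAt ℂ g (diag p)) (hgV : ∀ᶠ q in 𝓝 p, g (diag q) = V q)
    (hV : V ∈ sections M (T10 M) p) {w : CVec n} (hw : w ∈ complexTangent M p) :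
    (fderiv ℂ g (diag p) w).2 = 0 := by
  funext k
  rw [← along_snd_eq hg hgV]
  refine hw _ (analyticAt_snd hV.1 k) ?_
  filter_upwards [hV.2] with q hq
  exact congrFun (LinearMap.mem_ker.1 hq.1) k

lemma fderiv_fst_eq_zero {V : CField n} {g : CVec n → CVec n}
    (hg : DifferentiableAt ℂ g (diag p)) (hgV : ∀ᶠ q in 𝓝 p, g (diag q) = V q)
    (hV : V ∈ sections M (T01 M) p) {w : CVec n} (hw : w ∈ complexTangent M p) :
    (fderiv ℂ g (diag p) w).1 = 0 := by
  funext k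
  rw [← along_fst_eq hg hgV]
  refine hw _ (analyticAt_fst hV.1 k) ?_
  filter_upwards [hV.2] with q hq
  exact congrFun (LinearMap.mem_ker.1 hq.1) k

/-- Differentiating `dR(V) = 0` along a tangent vector. -/
lemma IsDefiningAt.fderiv_section (h : IsDefiningAt M R p) {V : CField n}
    {g : CVec n → CVec n} (hg : AnalyticAt ℂ g (diag p))
    (hgV : ∀ᶠ q in 𝓝 p, g (diag q) = V q) (hV : V ∈ sections M (complexTangent M) p)
    {w : CVec n} (hw : w ∈ complexTangent M p) :
    fderiv ℂ R (diag p) (fderiv ℂ g (diag p) w) =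
      -fderiv ℂ (fderiv ℂ R) (diag p) w (V p) := by
  have hR := h.analyticAt.fderiv
  have h1 : AnalyticAt ℂ (fun y => fderiv ℂ R y (g y)) (diag p) := analyticAt_clm_apply hR hg
  have h2 := hR.differentiableAt.hasFDerivAt.clm_apply hg.differentiableAt.hasFDerivAt
  have h3 : along w (fun q => fderiv ℂ R (diag q) (g (diag q))) p = 0 := by
    refine hw _ (AnalyticAt.comp (g := fun y => fderiv ℂ R y (g y)) (f := diag)
      (h1.restrictScalars (𝕜 := ℝ)) (diag.analyticAt p)) ?_
    filter_upwards [hV.2, h.eventually.filter_mono nhdsWithin_le_nhds,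
      hgV.filter_mono nhdsWithin_le_nhds, self_mem_nhdsWithin] with q e1 e2 e3 e4
    rw [e3]
    exact (e2.mem_complexTangent e4).1 e1
  rw [along_eq_fderiv h1.differentiableAt (Eventually.of_forall fun _ => rfl), h2.fderiv] at h3
  simp only [add_apply, ContinuousLinearMap.comp_apply, ContinuousLinearMap.flip_apply] at h3
  rw [← hgV.self_of_nhds]
  linear_combination h3

lemma mem_T10 {v : CVec n} : v ∈ T10 M p ↔ v.2 = 0 ∧ v ∈ complexTangent M p := by
  simp [T10]

lemma mem_T01 {v : CVec n} : v ∈ T01 M p ↔ v.1 = 0 ∧ v ∈ complexTangent M p := by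
  simp [T01]

lemma conjVec_mem_T01 {v : CVec n} (hv : v ∈ T10 M p) : conjVec v ∈ T01 M p := by
  rw [mem_T10] at hv
  exact mem_T01.2 ⟨by simp [conjVec, hv.1], conjVec_mem hv.2⟩

lemma conjVec_mem_T10 {v : CVec n} (hv : v ∈ T01 M p) : conjVec v ∈ T10 M p := by
  rw [mem_T01] at hv
  exact mem_T10.2 ⟨by simp [conjVec, hv.1], conjVec_mem hv.2⟩

lemma mem_T10_sup_T01 {v : CVec n} :
    v ∈ T10 M p ⊔ T01 M p ↔ (v.1, 0) ∈ T10 M p ∧ (0, v.2) ∈ T01 M p := by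
  constructor
  · intro hv
    obtain ⟨a, ha, b, hb, rfl⟩ := Submodule.mem_sup.1 hv
    have ha2 := (mem_T10.1 ha).1
    have hb1 := (mem_T01.1 hb).1
    have e1 : ((a + b).1, (0 : Fin n → ℂ)) = a := by ext k <;> simp [hb1, ha2]
    have e2 : ((0 : Fin n → ℂ), (a + b).2) = b := by ext k <;> simp [hb1, ha2]
    rw [e1, e2]
    exact ⟨ha, hb⟩
  · rintro ⟨h1, h2⟩
    have : v = (v.1, 0) + (0, v.2) := by simp
    rw [this]
    exact Submodule.add_mem_sup h1 h2

lemma IsDefiningAt.hessian_symm (h : IsDefiningAt M R p) (v w : CVec n) :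
    fderiv ℂ (fderiv ℂ R) (diag p) v w = fderiv ℂ (fderiv ℂ R) (diag p) w v :=
  (h.analyticAt.contDiffAt (n := ω)).isSymmSndFDerivAt_of_omega v w

/-- In `[V, W]`, the derivative of `W` along `V` has type (0,1) and the derivative of `V` along `W`
has type (1,0), so only the second contributes here. -/
lemma bracket_fst {V W : CField n} (hp : p ∈ M) (hV : V ∈ sections M (T10 M) p)
    (hW : W ∈ sections M (T01 M) p) {g : CVec n → CVec n}
    (hg : DifferentiableAt ℂ g (diag p)) (hgV : ∀ᶠ q in 𝓝 p, g (diag q) = V q) :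
    ((bracket V W p).1, (0 : Fin n → ℂ)) = -fderiv ℂ g (diag p) (W p) := by
  obtain ⟨g', hg', hgW⟩ := exists_complexification hW.1
  have hVp := hV.2.self_of_nhdsWithin hp
  have hWp := hW.2.self_of_nhdsWithin hp
  rw [bracket_eq hg hgV hg'.differentiableAt hgW]
  refine Prod.ext ?_ ?_
  · simp [fderiv_fst_eq_zero hg'.differentiableAt hgW hW hVp.2]
  · simp [fderiv_snd_eq_zero hg hgV hV hWp.2]

lemma bracket_snd {V W : CField n} (hp : p ∈ M) (hV : V ∈ sections M (T10 M) p)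
    (hW : W ∈ sections M (T01 M) p) {g : CVec n → CVec n}
    (hg : DifferentiableAt ℂ g (diag p)) (hgW : ∀ᶠ q in 𝓝 p, g (diag q) = W q) :
    ((0 : Fin n → ℂ), (bracket V W p).2) = fderiv ℂ g (diag p) (V p) := by
  obtain ⟨g', hg', hgV⟩ := exists_complexification hV.1
  have hVp := hV.2.self_of_nhdsWithin hp
  have hWp := hW.2.self_of_nhdsWithin hp
  rw [bracket_eq hg'.differentiableAt hgV hg hgW]
  refine Prod.ext ?_ ?_
  · simp [fderiv_fst_eq_zero hg hgW hW hVp.2]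
  · simp [fderiv_snd_eq_zero hg'.differentiableAt hgV hV hWp.2]

/-- The two types of `[V, W̄]` must be tangent separately. By `fderiv_section`, `dR` of the
derivative of `V` along `W̄` is `-D²R(W̄, V)`, and `dR` of the derivative of `W̄` along `V` is
`-D²R(V, W̄)`. Symmetry of the Hessian makes the two conditions one. -/
lemma IsDefiningAt.leviForm_eq_zero_iff (h : IsDefiningAt M R p) (hp : p ∈ M)
    (V W : sections M (T10 M) p) :
    leviForm M p V W = 0 ↔ fderiv ℂ (fderiv ℂ R) (diag p)
      (conjVec ((W : CField n) p)) ((V : CField n) p) = 0 := by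
  have hVp := V.2.2.self_of_nhdsWithin hp
  have hW := conjField_mem W.2
  have hWp := hW.2.self_of_nhdsWithin hp
  obtain ⟨g, hg, hgV⟩ := exists_complexification V.2.1
  obtain ⟨g', hg', hgW⟩ := exists_complexification hW.1
  have e : leviForm M p V W = Complex.I • (T10 M p ⊔ T01 M p).mkQ
      (bracket (V : CField n) (conjField (W : CField n)) p) := rfl
  rw [e, smul_eq_zero_iff_right Complex.I_ne_zero, Submodule.mkQ_apply,
    Submodule.Quotient.mk_eq_zero, mem_T10_sup_T01, mem_T10, mem_T01,
    h.mem_complexTangent hp, h.mem_complexTangent hp,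
    bracket_fst hp V.2 hW hg.differentiableAt hgV, bracket_snd hp V.2 hW hg'.differentiableAt hgW,
    map_neg, h.fderiv_section hg hgV (sections_T10_le V.2) hWp.2,
    h.fderiv_section hg' hgW (sections_T01_le hW) hVp.2,
    h.hessian_symm ((V : CField n) p)]
  have z1 := fderiv_snd_eq_zero hg.differentiableAt hgV V.2 hWp.2
  have z2 := fderiv_fst_eq_zero hg'.differentiableAt hgW hW hVp.2
  simp only [Prod.snd_neg, z1, z2, neg_zero, neg_neg, neg_eq_zero, true_and, and_self]
  rfl

/-- Every vector in `T^{1,0}_p M` extends to a section. -/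
lemma IsDefiningAt.exists_section (h : IsDefiningAt M R p) (hp : p ∈ M) {v : CVec n}
    (hv : v ∈ T10 M p) : ∃ V ∈ sections M (T10 M) p, V p = v := by
  obtain ⟨e, he⟩ := h.exists_fst
  rw [mem_T10, h.mem_complexTangent hp] at hv
  have hA : ∀ x, AnalyticAt ℝ (fun q => fderiv ℂ R (diag q) x) p := fun x =>
    AnalyticAt.comp (g := fun y => fderiv ℂ R y x) (f := diag)
      ((analyticAt_clm_apply h.analyticAt.fderiv analyticAt_const).restrictScalars (𝕜 := ℝ))
      (diag.analyticAt p)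
  have hne : ∀ᶠ q in 𝓝 p, fderiv ℂ R (diag q) (e, 0) ≠ 0 := (hA _).continuousAt.eventually_ne he
  -- Correct the constant field `v` along the transverse vector `(e, 0)` so that `dR` kills it at
  -- every point near `p`; at `p` the correction is zero.
  refine ⟨fun q => v - (fderiv ℂ R (diag q) v / fderiv ℂ R (diag q) (e, 0)) • ((e, 0) : CVec n),
    ⟨?_, ?_⟩, ?_⟩
  · exact analyticAt_const.sub (((hA v).div (hA _) he).smul analyticAt_const)
  · filter_upwards [h.eventually.filter_mono nhdsWithin_le_nhds, self_mem_nhdsWithin,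
      hne.filter_mono nhdsWithin_le_nhds] with q h1 h2 h3
    rw [mem_T10, h1.mem_complexTangent h2]
    refine ⟨by simp [hv.1], ?_⟩
    rw [map_sub, map_smul, smul_eq_mul, div_mul_cancel₀ _ h3, sub_self]
  · simp [hv.2]

lemma IsDefiningAt.mem_leviKernel (h : IsDefiningAt M R p) (hp : p ∈ M) {v : CVec n} :
    v ∈ leviKernel M p ↔ v ∈ T10 M p ∧
      ∀ w ∈ T10 M p, fderiv ℂ (fderiv ℂ R) (diag p) (conjVec w) v = 0 := by
  constructor
  · rintro ⟨_, ⟨V, hV, rfl⟩, rfl⟩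
    refine ⟨V.2.2.self_of_nhdsWithin hp, fun w hw => ?_⟩
    obtain ⟨W, hW, rfl⟩ := h.exists_section hp hw
    refine (h.leviForm_eq_zero_iff hp V ⟨W, hW⟩).1 ?_
    rw [LinearMap.mem_ker.1 hV]
    rfl
  · rintro ⟨hv, hvw⟩
    obtain ⟨V, hV, rfl⟩ := h.exists_section hp hv
    refine ⟨V, ⟨⟨V, hV⟩, ?_, rfl⟩, rfl⟩
    refine LinearMap.mem_ker.2 (LinearMap.ext fun W => ?_)
    exact (h.leviForm_eq_zero_iff hp ⟨V, hV⟩ W).2 (hvw _ (W.2.2.self_of_nhdsWithin hp))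

lemma IsDefiningAt.exists_hessian_ne_zero (h : IsDefiningAt M R p) (hp : p ∈ M)
    (hrank : leviRank M p = 1) : ∃ v ∈ T10 M p, ∃ w ∈ T10 M p,
      fderiv ℂ (fderiv ℂ R) (diag p) (conjVec w) v ≠ 0 := by
  by_contra! hc
  have : leviForm M p = 0 := by
    refine LinearMap.ext fun V => LinearMap.ext fun W => ?_
    exact (h.leviForm_eq_zero_iff hp V W).2 (hc _ (V.2.2.self_of_nhdsWithin hp) _
      (W.2.2.self_of_nhdsWithin hp))
  rw [leviRank, this, LinearMap.range_zero] at hrank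
  simp at hrank

/-- In `ℂ³` one linear equation leaves `T^{1,0}` of dimension at least `2`, while the Levi form
sends sections to a line; some nontrivial combination of two independent sections is therefore
killed. -/
lemma IsDefiningAt.exists_leviKernel_ne_zero {M : Set (Fin 3 → ℂ)} {R : CVec 3 → ℂ}
    {p : Fin 3 → ℂ} (h : IsDefiningAt M R p) (hp : p ∈ M)
    (hrank : leviRank M p = 1) : ∃ v ∈ leviKernel M p, v ≠ 0 := by
  set A : (Fin 3 → ℂ) →ₗ[ℂ] ℂ :=
    ((fderiv ℂ R (diag p)).comp (ContinuousLinearMap.inl ℂ _ _)).toLinearMap with hA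
  have hmem : ∀ a, a ∈ LinearMap.ker A → (a, 0) ∈ T10 M p := fun a ha => by
    rw [mem_T10, h.mem_complexTangent hp]
    exact ⟨rfl, ha⟩
  have hdim : 2 ≤ Module.finrank ℂ (LinearMap.ker A) := by
    have h1 := A.finrank_range_add_finrank_ker
    have h2 : Module.finrank ℂ (LinearMap.range A) ≤ 1 := by
      simpa using Submodule.finrank_le (LinearMap.range A)
    simp at h1
    omega
  obtain ⟨x, hx⟩ : ∃ x : LinearMap.ker A, x ≠ 0 :=
    (Module.finrank_pos_iff_exists_ne_zero (R := ℂ)).1 (by omega)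
  obtain ⟨y, hxy⟩ := exists_linearIndependent_pair_of_one_lt_finrank (R := ℂ) (by omega) hx
  obtain ⟨X, hX, hXp⟩ := h.exists_section hp (hmem x x.2)
  obtain ⟨Y, hY, hYp⟩ := h.exists_section hp (hmem y y.2)
  have : Module.Free ℂ (LinearMap.range (leviForm M p)) :=
    Module.Free.of_divisionRing ℂ (LinearMap.range (leviForm M p))
  obtain ⟨b, -, hb⟩ := (finrank_eq_one_iff' (K := ℂ) (V := LinearMap.range (leviForm M p))).1 hrank
  obtain ⟨c, hc⟩ := hb ⟨leviForm M p ⟨X, hX⟩, ⟨⟨X, hX⟩, rfl⟩⟩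
  obtain ⟨d, hd⟩ := hb ⟨leviForm M p ⟨Y, hY⟩, ⟨⟨Y, hY⟩, rfl⟩⟩
  have hc' : c • b.1 = leviForm M p ⟨X, hX⟩ := congrArg Subtype.val hc
  have hd' : d • b.1 = leviForm M p ⟨Y, hY⟩ := congrArg Subtype.val hd
  obtain ⟨s, t, hst, hker⟩ : ∃ s t : ℂ, (s ≠ 0 ∨ t ≠ 0) ∧
      leviForm M p (s • ⟨X, hX⟩ + t • ⟨Y, hY⟩) = 0 := by
    by_cases h0 : c = 0
    · exact ⟨1, 0, by simp, by simp [← hc', h0]⟩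
    · refine ⟨d, -c, by simp [h0], ?_⟩
      rw [map_add, map_smul, map_smul, ← hc', ← hd', smul_smul, smul_smul, ← add_smul]
      simp [mul_comm]
  refine ⟨s • (x.1, 0) + t • (y.1, 0), ⟨_, ⟨_, LinearMap.mem_ker.2 hker, rfl⟩, ?_⟩, fun h0 => ?_⟩
  · simp [hXp, hYp]
  · have h1 : s • x + t • y = 0 := Subtype.ext (by simpa using congrArg Prod.fst h0)
    have := LinearIndependent.pair_iff.1 hxy s t h1
    tauto

end CRGeom

namespace CRGeom

/-! ### A normalized section of the Levi kernel in `ℂ³` -/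

open scoped Matrix

variable {M : Set (Fin 3 → ℂ)} {R : CVec 3 → ℂ} {p : Fin 3 → ℂ}

/-- A common solution of two linear equations in `ℂ³` is parallel to the cross product of their
coefficient vectors. -/
lemma cross_mul_eq {α β a : Fin 3 → ℂ} (hα : a ⬝ᵥ α = 0) (hβ : a ⬝ᵥ β = 0) (i j : Fin 3) :
    (α ⨯₃ β) i * a j = (α ⨯₃ β) j * a i := by
  simp only [dotProduct, Fin.sum_univ_three] at hα hβ
  rw [cross_apply]
  fin_cases i <;> fin_cases j <;> simp
  · linear_combination β 2 * hα - α 2 * hβ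
  · linear_combination -β 1 * hα + α 1 * hβ
  · linear_combination -β 2 * hα + α 2 * hβ
  · linear_combination β 0 * hα - α 0 * hβ
  · linear_combination β 1 * hα - α 1 * hβ
  · linear_combination -β 0 * hα + α 0 * hβ

/-- The coefficients of a covector on the vectors of type `(1,0)`. -/
def holCoeff (A : CVec 3 →L[ℂ] ℂ) : Fin 3 → ℂ := fun k => A (Pi.single k 1, 0)

lemma dotProduct_holCoeff (A : CVec 3 →L[ℂ] ℂ) (a : Fin 3 → ℂ) : a ⬝ᵥ holCoeff A = A (a, 0) := by
  have : ((a, 0) : CVec 3) = ∑ k, a k • (Pi.single k 1, 0) := by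
    ext k <;> simp [Finset.sum_apply, Prod.fst_sum, Prod.snd_sum, Pi.single_apply]
  rw [this, map_sum]
  simp only [map_smul, dotProduct, holCoeff, smul_eq_mul]

lemma analyticAt_holCoeff {A : (Fin 3 → ℂ) → CVec 3 →L[ℂ] ℂ} (hA : AnalyticAt ℝ A p)
    (k : Fin 3) : AnalyticAt ℝ (fun q => holCoeff (A q) k) p :=
  (((ContinuousLinearMap.apply ℂ ℂ ((Pi.single k 1, 0) : CVec 3)).restrictScalars ℝ).analyticAt
    _).comp hA

/-- A kernel vector `(a, 0)` satisfies `dR(a, 0) = 0` and `D²R(W̄, (a, 0)) = 0` for one fixed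
section `W` with nonzero Levi pairing at `p`. These two equations are independent near `p`, so they
define a line, spanned by a cross product that is analytic in `q`. The rank hypothesis makes the
kernel nonzero, so on `M` it is this line. The last clause is kept for the independence of the first
integrals used as coordinates. -/
lemma IsDefiningAt.exists_leviKernel_section (h : IsDefiningAt M R p) (hp : p ∈ M)
    (hrank : ∀ q ∈ M, leviRank M q = 1) :
    ∃ (K : (Fin 3 → ℂ) → Fin 3 → ℂ) (j : Fin 3), AnalyticAt ℝ K p ∧ (∀ᶠ q in 𝓝 p, K q j = 1) ∧
      (∀ᶠ q in 𝓝[M] p, (K q, 0) ∈ leviKernel M q) ∧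
      (∀ᶠ q in 𝓝[M] p, ∀ v ∈ leviKernel M q, v.1 j = 0 → v = 0) ∧
      ∃ w ∈ T10 M p, ∀ v ∈ T10 M p,
        fderiv ℂ (fderiv ℂ R) (diag p) (conjVec w) v = 0 → v.1 j = 0 → v = 0 := by
  obtain ⟨v₀, hv₀, w₀, hw₀, hvw⟩ := h.exists_hessian_ne_zero hp (hrank p hp)
  obtain ⟨W, hW, rfl⟩ := h.exists_section hp hw₀
  let A : (Fin 3 → ℂ) → CVec 3 →L[ℂ] ℂ := fun q => fderiv ℂ R (diag q)
  let B : (Fin 3 → ℂ) → CVec 3 →L[ℂ] ℂ := fun q =>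
    fderiv ℂ (fderiv ℂ R) (diag q) (conjField W q)
  have hA : AnalyticAt ℝ A p := AnalyticAt.comp (g := fderiv ℂ R) (f := diag)
    (h.analyticAt.fderiv.restrictScalars (𝕜 := ℝ)) (diag.analyticAt p)
  have hB : AnalyticAt ℝ B p := by
    have h1 : AnalyticAt ℝ (fun q => fderiv ℂ (fderiv ℂ R) (diag q)) p :=
      AnalyticAt.comp (g := fderiv ℂ (fderiv ℂ R)) (f := diag)
        (h.analyticAt.fderiv.fderiv.restrictScalars (𝕜 := ℝ)) (diag.analyticAt p)
    have h2 : AnalyticAt ℂ (fun z : (CVec 3 →L[ℂ] CVec 3 →L[ℂ] ℂ) × CVec 3 => z.1 z.2)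
        (fderiv ℂ (fderiv ℂ R) (diag p), conjField W p) :=
      analyticAt_clm_apply _root_.analyticAt_fst _root_.analyticAt_snd
    exact AnalyticAt.comp
      (g := fun z : (CVec 3 →L[ℂ] CVec 3 →L[ℂ] ℂ) × CVec 3 => z.1 z.2)
      (f := fun q => (fderiv ℂ (fderiv ℂ R) (diag q), conjField W q))
      (h2.restrictScalars (𝕜 := ℝ)) (h1.prod (analyticAt_conjField hW.1))
  let N : (Fin 3 → ℂ) → Fin 3 → ℂ := fun q => holCoeff (A q) ⨯₃ holCoeff (B q)
  have hN : ∀ k, AnalyticAt ℝ (fun q => N q k) p := fun k => by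
    have h1 := analyticAt_holCoeff hA
    have h2 := analyticAt_holCoeff hB
    simp only [N, cross_apply]
    fin_cases k
    · exact ((h1 1).mul (h2 2)).sub ((h1 2).mul (h2 1))
    · exact ((h1 2).mul (h2 0)).sub ((h1 0).mul (h2 2))
    · exact ((h1 0).mul (h2 1)).sub ((h1 1).mul (h2 0))
  -- A dependence between the two equations is tested on `v₀`, which is tangent but pairs
  -- nontrivially with `W`, and then on `e`, which is not tangent.
  have hN0 : N p ≠ 0 := fun h0 => by
    obtain ⟨e, he⟩ := h.exists_fst
    have hdep : ¬ LinearIndependent ℂ ![holCoeff (A p), holCoeff (B p)] := fun hi =>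
      crossProduct_ne_zero_iff_linearIndependent.2 hi h0
    rw [LinearIndependent.pair_iff] at hdep
    push Not at hdep
    obtain ⟨s, t, hst, hne⟩ := hdep
    have key : ∀ a, s * A p (a, 0) + t * B p (a, 0) = 0 := fun a => by
      have := congrArg (fun u => a ⬝ᵥ u) hst
      simpa [dotProduct_add, dotProduct_smul, dotProduct_holCoeff] using this
    have hv1 := key v₀.1
    rw [mem_T10, h.mem_complexTangent hp] at hv₀
    have hv2 : ((v₀.1, 0) : CVec 3) = v₀ := Prod.ext rfl hv₀.1.symm
    rw [hv2] at hv1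
    have ht : t = 0 := by
      have h3 : A p v₀ = 0 := hv₀.2
      have h4 : B p v₀ ≠ 0 := hvw
      rw [h3, mul_zero, zero_add] at hv1
      exact (mul_eq_zero.1 hv1).resolve_right h4
    have hs : s = 0 := by
      have := key e
      rw [ht, zero_mul, add_zero] at this
      exact (mul_eq_zero.1 this).resolve_right he
    exact hne hs ht
  obtain ⟨j, hj⟩ := Function.ne_iff.1 hN0
  have hNj : ∀ᶠ q in 𝓝 p, N q j ≠ 0 := (hN j).continuousAt.eventually_ne hj
  have hzero : ∀ᶠ q in 𝓝[M] p, ∀ v ∈ T10 M q, B q v = 0 → v.1 j = 0 → v = 0 := by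
    filter_upwards [hNj.filter_mono nhdsWithin_le_nhds, self_mem_nhdsWithin,
      h.eventually.filter_mono nhdsWithin_le_nhds] with q h1 h2 h3 v hv hBv hvj
    rw [mem_T10, h3.mem_complexTangent h2] at hv
    have hv2 : ((v.1, 0) : CVec 3) = v := Prod.ext rfl hv.1.symm
    refine Prod.ext (funext fun i => ?_) hv.1
    have := cross_mul_eq (a := v.1) (α := holCoeff (A q)) (β := holCoeff (B q))
      (by rw [dotProduct_holCoeff, hv2]; exact hv.2) (by rw [dotProduct_holCoeff, hv2]; exact hBv)
      i j
    rw [hvj, mul_zero] at this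
    exact (mul_eq_zero.1 this.symm).resolve_left h1
  have hker : ∀ᶠ q in 𝓝[M] p, ∀ v ∈ leviKernel M q, v ∈ T10 M q ∧ B q v = 0 := by
    filter_upwards [hW.2, self_mem_nhdsWithin,
      h.eventually.filter_mono nhdsWithin_le_nhds] with q h1 h2 h3 v hv
    rw [h3.mem_leviKernel h2] at hv
    exact ⟨hv.1, hv.2 _ h1⟩
  refine ⟨fun q => (N q j)⁻¹ • N q, j, ?_, ?_, ?_, ?_, W p, hw₀, ?_⟩
  · exact ((hN j).inv hj).smul (analyticAt_pi_iff.2 hN)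
  · filter_upwards [hNj] with q hq
    simp [hq]
  · filter_upwards [hNj.filter_mono nhdsWithin_le_nhds, self_mem_nhdsWithin,
      h.eventually.filter_mono nhdsWithin_le_nhds, hker, hzero] with q h1 h2 h3 h4 h5
    obtain ⟨v, hv, hv0⟩ := h3.exists_leviKernel_ne_zero h2 (hrank q h2)
    obtain ⟨hvT, hvB⟩ := h4 v hv
    have hvj : v.1 j ≠ 0 := fun h0 => hv0 (h5 v hvT hvB h0)
    rw [mem_T10, h3.mem_complexTangent h2] at hvT
    have hv2 : ((v.1, 0) : CVec 3) = v := Prod.ext rfl hvT.1.symm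
    have : (((N q j)⁻¹ • N q, 0) : CVec 3) = (v.1 j)⁻¹ • v := by
      refine Prod.ext (funext fun i => ?_) (by simp [hvT.1])
      have := cross_mul_eq (a := v.1) (α := holCoeff (A q)) (β := holCoeff (B q))
        (by rw [dotProduct_holCoeff, hv2]; exact hvT.2)
        (by rw [dotProduct_holCoeff, hv2]; exact hvB) i j
      change N q i * v.1 j = N q j * v.1 i at this
      simp only [Pi.smul_apply, Prod.smul_fst, smul_eq_mul]
      field_simp
      linear_combination this
    rw [this]
    exact Submodule.smul_mem _ _ hv
  · filter_upwards [hker, hzero] with q h1 h2 v hv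
    exact h2 v (h1 v hv).1 (h1 v hv).2
  · exact hzero.self_of_nhdsWithin hp

/-- If the Freeman form vanishes, then the normalized section of the Levi kernel is CR. -/
lemma IsDefiningAt.along_leviKernel_section_eq_zero (h : IsDefiningAt M R p)
    (hF : ∀ q ∈ M, freemanForm M q = 0) {K : (Fin 3 → ℂ) → Fin 3 → ℂ} {j : Fin 3}
    (hK : AnalyticAt ℝ K p) (hKj : ∀ᶠ q in 𝓝 p, K q j = 1)
    (hKker : ∀ᶠ q in 𝓝[M] p, (K q, 0) ∈ leviKernel M q)
    (hzero : ∀ᶠ q in 𝓝[M] p, ∀ v ∈ leviKernel M q, v.1 j = 0 → v = 0) :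
    ∀ᶠ q in 𝓝[M] p, ∀ w ∈ T01 M q, ∀ k, along w (fun x => K x k) q = 0 := by
  filter_upwards [hK.eventually_analyticAt.filter_mono nhdsWithin_le_nhds,
    (eventually_eventually_nhds.2 hKj).filter_mono nhdsWithin_le_nhds,
    eventually_eventually_nhdsWithin.2 hKker, hzero, self_mem_nhdsWithin,
    h.eventually.filter_mono nhdsWithin_le_nhds] with q h1 h2 h3 h4 h5 h6 w hw k
  have hV : (fun x => (K x, 0) : CField 3) ∈ sections M (leviKernel M) q :=
    ⟨h1.prod analyticAt_const, h3⟩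
  have hVT : (fun x => (K x, 0) : CField 3) ∈ sections M (T10 M) q := by
    refine ⟨hV.1, ?_⟩
    filter_upwards [h3, self_mem_nhdsWithin, h6.eventually.filter_mono nhdsWithin_le_nhds]
      with x e1 e2 e3
    exact ((e3.mem_leviKernel e2).1 e1).1
  obtain ⟨W, hW, hWq⟩ := h6.exists_section h5 (conjVec_mem_T10 hw)
  have hW' := conjField_mem hW
  have hWw : conjField W q = w := by rw [conjField, hWq, conjVec_conjVec]
  have h7 : (leviKernel M q ⊔ T01 M q).mkQ
      (bracket (fun x => (K x, 0) : CField 3) (conjField W) q) = 0 :=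
    congrArg (fun f => f ⟨_, hV⟩ ⟨W, hW⟩) (hF q h5)
  rw [Submodule.mkQ_apply, Submodule.Quotient.mk_eq_zero] at h7
  obtain ⟨a, ha, b, hb, hab⟩ := Submodule.mem_sup.1 h7
  obtain ⟨g, hg, hgV⟩ := exists_complexification hV.1
  have h8 := bracket_fst h5 hVT hW' hg.differentiableAt hgV
  -- Compare (1,0)-parts: `a` is in the Levi kernel, so of type (1,0), and `b` is of type (0,1).
  have ha' : a = -fderiv ℂ g (diag q) w := by
    rw [← hWw, ← h8, ← hab]
    have ha2 := (mem_T10.1 ((h6.mem_leviKernel h5).1 ha).1).1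
    have hb1 := (mem_T01.1 hb).1
    ext i <;> simp [ha2, hb1]
  have h9 : ∀ i, along w (fun x => K x i) q = -a.1 i := fun i => by
    rw [ha']
    simpa using along_fst_eq hg.differentiableAt hgV w i
  -- The coefficient `K_j` is constantly `1`, so `a` is a kernel vector whose `j`-th coefficient is
  -- `0`.
  have h10 : a = 0 := by
    refine h4 a ha ?_
    rw [← neg_eq_zero, ← h9, along_eq_fderiv (g := fun _ => 1) (by fun_prop)]
    · simp
    · filter_upwards [h2] with x hx using hx.symm
  rw [h9, h10]
  simp

end CRGeom

namespace CRGeom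

variable {n : ℕ}

/-! ### Holomorphic functions on the complexification of `M` -/

variable {M : Set (Fin n → ℂ)} {R : CVec n → ℂ} {p : Fin n → ℂ}

lemma continuous_conjVec : Continuous (conjVec : CVec n → CVec n) := by
  unfold conjVec
  fun_prop

/-- Hermitian symmetry: `y ↦ star (R (conjVec y))` is holomorphic and agrees with `R` on the
diagonal, where `R` is real. -/
lemma IsDefiningAt.eventually_conjVec (h : IsDefiningAt M R p) :
    ∀ᶠ y in 𝓝 (diag p), R (conjVec y) = star (R y) := by
  have hc : Tendsto (conjVec : CVec n → CVec n) (𝓝 (diag p)) (𝓝 (diag p)) :=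
    continuous_conjVec.tendsto' _ _ (conjVec_diag p)
  have hd : ∀ᶠ y in 𝓝 (diag p), DifferentiableAt ℂ R y := by
    filter_upwards [h.analyticAt.eventually_analyticAt] with y hy using hy.differentiableAt
  have key := eventually_eq_zero_of_diag (g := fun y => star (R (conjVec y)) - R y) (p := p) ?_ ?_
  · filter_upwards [key] with y hy
    rw [← sub_eq_zero.1 hy, star_star]
  · filter_upwards [hd, hc.eventually hd] with y h1 h2
    refine DifferentiableAt.sub ?_ h1
    have h3 : DifferentiableAt ℂ (star ∘ R ∘ star) (star (conjVec y)) := h2.star_star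
    have h4 : DifferentiableAt ℂ (fun y : CVec n => ((y.2, y.1) : CVec n)) y := by fun_prop
    have h5 : star (conjVec y) = (y.2, y.1) := by simp [conjVec, Prod.star_def]
    rw [h5] at h3
    exact DifferentiableAt.comp (g := star ∘ R ∘ star) (f := fun y : CVec n => (y.2, y.1)) y h3 h4
  · filter_upwards [h.im_eq_zero] with q hq
    rw [conjVec_diag, RCLike.star_def, Complex.conj_eq_iff_im.2 hq, sub_self]

/-- A holomorphic function which vanishes at the points `(q, q̄)`, `q ∈ M`, vanishes on the
complexification `{R = 0}` of `M`. -/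
lemma IsDefiningAt.eventually_eq_zero {F : Type*} [NormedAddCommGroup F] [NormedSpace ℂ F]
    [CompleteSpace F] (h : IsDefiningAt M R p) (hp : p ∈ M) {H : CVec n → F}
    (hH : AnalyticAt ℂ H (diag p)) (h0 : ∀ᶠ q in 𝓝[M] p, H (diag q) = 0) :
    ∀ᶠ y in 𝓝 (diag p), R y = 0 → H y = 0 := by
  obtain ⟨e, he⟩ := h.exists_diag
  set P := diag p with hP
  have hRP : R P = 0 := h.mem_iff.self_of_nhds.1 hp
  set L := fderiv ℂ R P with hL
  -- `A` is tangent to the identity at `P` and carries `{R = 0}` into the hyperplane `L (x - P) =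
  -- 0`. Correcting along the real vector `diag e` makes it commute with conjugation.
  set A : CVec n → CVec n := fun x => x + (R x - L (x - P)) • diag e with hA
  have hAP : A P = P := by simp [hA, hRP]
  have hLA : ∀ x, L (A x - P) = R x := fun x => by
    rw [hA]
    simp only
    rw [add_sub_right_comm, map_add, map_smul, he, smul_eq_mul]
    ring
  have hAan : AnalyticAt ℂ A P := by
    have h1 : AnalyticAt ℂ (fun x => L (x - P)) P :=
      (L.analyticAt _).comp (analyticAt_id.sub analyticAt_const)
    exact analyticAt_id.add ((h.analyticAt.sub h1).smul analyticAt_const)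
  have hA' : HasFDerivAt A ((ContinuousLinearEquiv.refl ℂ (CVec n) : CVec n ≃L[ℂ] CVec n) :
      CVec n →L[ℂ] CVec n) P := by
    have h1 : HasFDerivAt (fun x => L (x - P)) L P :=
      L.hasFDerivAt.comp P ((hasFDerivAt_id P).sub_const P)
    have h2 := (hasFDerivAt_id P).add
      ((h.analyticAt.differentiableAt.hasFDerivAt.sub h1).smul_const (diag e))
    refine h2.congr_fderiv ?_
    rw [← hL, sub_self]
    ext x <;> simp
  have hcd : ContDiffAt ℂ ω A P := hAan.contDiffAt
  have hst := hcd.hasStrictFDerivAt' hA' (by simp)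
  set B := hcd.localInverse hA' (by simp) with hB
  have hBan : AnalyticAt ℂ B P := by
    have := hcd.to_localInverse hA' (by simp)
    rw [hAP] at this
    exact this.analyticAt
  have hBP : B P = P := by
    have := hcd.localInverse_apply_image hA' (by simp)
    rwa [hAP] at this
  have hBA : ∀ᶠ x in 𝓝 P, B (A x) = x := hst.eventually_left_inverse
  have hAB : ∀ᶠ x in 𝓝 P, A (B x) = x := by
    have := hst.eventually_right_inverse
    rwa [hAP] at this
  have hBt : Tendsto B (𝓝 P) (𝓝 P) := by
    have := hBan.continuousAt.tendsto
    rwa [hBP] at this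
  have hct : Tendsto (conjVec : CVec n → CVec n) (𝓝 P) (𝓝 P) :=
    continuous_conjVec.tendsto' _ _ (conjVec_diag p)
  have hAc : ∀ᶠ x in 𝓝 P, A (conjVec x) = conjVec (A x) := by
    filter_upwards [h.eventually_conjVec] with x hx
    have h1 : conjVec x - P = conjVec (x - P) := by
      conv_lhs => rw [hP, ← conjVec_diag p]
      ext k <;> simp [conjVec, hP]
    have h2 : L (conjVec (x - P)) = star (L (x - P)) := h.fderiv_conjVec _
    simp only [hA]
    rw [hx, h1, h2]
    ext k <;> simp [conjVec, diag_apply]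
  -- The local inverse `B` also commutes with conjugation there, so it preserves the diagonal, the
  -- fixed set of `conjVec`.
  have hBdiag : ∀ᶠ q in 𝓝 p, B (diag q) = diag (B (diag q)).1 := by
    have hdt : Tendsto (fun q => diag q) (𝓝 p) (𝓝 P) := diag.continuous.tendsto p
    filter_upwards [hdt.eventually hAB, (hBt.comp hdt).eventually hAc,
      (hct.comp (hBt.comp hdt)).eventually hBA] with q h1 h2 h3
    simp only [Function.comp_apply] at h2 h3
    rw [h2, h1, conjVec_diag] at h3
    have h4 := congrArg Prod.snd h3
    exact Prod.ext rfl h4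
  -- The projection to the flat hyperplane preserves the diagonal, and `B` bends that hyperplane
  -- onto `{R = 0}`. Thus `H ∘ B ∘ π` is holomorphic on a full neighbourhood and takes on the
  -- diagonal only values of `H` over `M`.
  set π : CVec n → CVec n := fun x => x - L (x - P) • diag e with hπ
  have hπP : π P = P := by simp [hπ]
  have hLπ : ∀ x, L (π x - P) = 0 := fun x => by
    have : π x - P = (x - P) - L (x - P) • diag e := by simp only [hπ]; abel
    rw [this, map_sub, map_smul, he]
    simp
  have hπan : AnalyticAt ℂ π P := by
    have h1 : AnalyticAt ℂ (fun x => L (x - P)) P :=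
      (L.analyticAt _).comp (analyticAt_id.sub analyticAt_const)
    exact analyticAt_id.sub (h1.smul analyticAt_const)
  have hg : AnalyticAt ℂ (fun x => H (B (π x))) P := by
    refine AnalyticAt.comp_of_eq (g := H) (y := P) hH (AnalyticAt.comp_of_eq (g := B) (y := P)
      hBan hπan hπP) ?_
    simp only [hπP, hBP]
  have hg0 : ∀ᶠ q in 𝓝 p, H (B (π (diag q))) = 0 := by
    let σ : (Fin n → ℂ) → Fin n → ℂ := fun q => q - (L (diag (q - p))).re • e
    have hσ : ∀ q, π (diag q) = diag (σ q) := fun q => by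
      have h1 : ((L (diag (q - p))).re : ℂ) = L (diag (q - p)) :=
        Complex.ext (by simp) (by simpa using (h.fderiv_diag_im (q - p)).symm)
      simp only [hπ, σ]
      rw [map_sub diag q ((L (diag (q - p))).re • e), diag.map_smul, ← Complex.coe_smul, h1, hP,
        map_sub diag q p]
    have hσt : Tendsto σ (𝓝 p) (𝓝 p) := by
      have : ContinuousAt σ p := by fun_prop
      have h2 : σ p = p := by simp [σ]
      rw [ContinuousAt, h2] at this
      exact this
    have hdt : Tendsto (fun q => diag (σ q)) (𝓝 p) (𝓝 P) := (diag.continuous.tendsto p).comp hσt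
    have hft : Tendsto (fun q => (B (diag (σ q))).1) (𝓝 p) (𝓝 p) :=
      (continuous_fst.tendsto P).comp (hBt.comp hdt)
    filter_upwards [hσt.eventually hBdiag, hdt.eventually hAB,
      hft.eventually h.mem_iff, hft.eventually (eventually_nhdsWithin_iff.1 h0)] with q h1 h2 h3 h4
    rw [hσ, h1]
    refine h4 (h3.2 ?_)
    rw [← h1, ← hLA, h2, ← hσ, hLπ]
  have hz := eventually_eq_zero_of_diag (g := fun x => H (B (π x))) (p := p)
    (by filter_upwards [hg.eventually_analyticAt] with y hy using hy.differentiableAt) hg0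
  have hAt : Tendsto A (𝓝 P) (𝓝 P) := by
    have := hAan.continuousAt.tendsto
    rwa [hAP] at this
  filter_upwards [hAt.eventually hz, hBA] with y h1 h2 hy
  have h3 : π (A y) = A y := by simp only [hπ]; rw [hLA, hy]; simp
  rwa [h3, h2] at h1

end CRGeom

namespace CRGeom

variable {n : ℕ}

/-! ### Segre varieties as graphs -/

/-- The analytic implicit function theorem for one scalar equation. -/
lemma exists_analyticAt_implicit {𝕜 X : Type*} [RCLike 𝕜] [NormedAddCommGroup X] [NormedSpace 𝕜 X]
    [CompleteSpace X] {f : X × 𝕜 → 𝕜} {x : X} {s : 𝕜} (hf : AnalyticAt 𝕜 f (x, s))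
    (hf' : fderiv 𝕜 f (x, s) (0, 1) ≠ 0) :
    ∃ ψ : X → 𝕜, AnalyticAt 𝕜 ψ x ∧ ψ x = s ∧ (∀ᶠ y in 𝓝 x, f (y, ψ y) = f (x, s)) ∧
      ∀ᶠ v in 𝓝 (x, s), f v = f (x, s) ↔ ψ v.1 = v.2 := by
  have hc : ContDiffAt 𝕜 ω f (x, s) := hf.contDiffAt
  have hi : (fderiv 𝕜 f (x, s) ∘L .inr 𝕜 X 𝕜).IsInvertible :=
    ⟨ContinuousLinearEquiv.unitsEquivAut 𝕜 (Units.mk0 _ hf'), by ext; simp⟩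
  exact ⟨hc.implicitFunction (by simp) hi,
    (hc.contDiffAt_implicitFunction (by simp) hi).analyticAt,
    hc.implicitFunction_apply_self (by simp) hi, hc.eventually_apply_implicitFunction (by simp) hi,
    hc.eventually_apply_eq_iff_implicitFunction (by simp) hi⟩

variable {M : Set (Fin n → ℂ)} {R : CVec n → ℂ} {p : Fin n → ℂ}

/-- `Θ` solves `R = 0` for the coordinate along `(0, e)`: near `diag p`, the point
`y + Θ(y) (0, e)` is the point of `{R = 0}` on the line through `y` in the direction `(0, e)`. -/
structure IsSegreSolution (R : CVec n → ℂ) (p e : Fin n → ℂ) (Θ : CVec n → ℂ) : Prop where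
  analyticAt : AnalyticAt ℂ Θ (diag p)
  apply_self : Θ (diag p) = 0
  solves : ∀ᶠ y in 𝓝 (diag p), R (y + Θ y • (0, e)) = 0
  eq_zero_iff : ∀ᶠ y in 𝓝 (diag p), R y = 0 ↔ Θ y = 0

lemma IsDefiningAt.exists_isSegreSolution (h : IsDefiningAt M R p) (hp : p ∈ M) {e : Fin n → ℂ}
    (he : fderiv ℂ R (diag p) (0, e) ≠ 0) : ∃ Θ, IsSegreSolution R p e Θ := by
  have hRP : R (diag p) = 0 := h.mem_iff.self_of_nhds.1 hp
  set f : CVec n × ℂ → ℂ := fun u => R (u.1 + u.2 • (0, e)) with hf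
  have hin : AnalyticAt ℂ (fun u : CVec n × ℂ => u.1 + u.2 • ((0, e) : CVec n)) (diag p, 0) :=
    _root_.analyticAt_fst.add (_root_.analyticAt_snd.smul analyticAt_const)
  have hfa : AnalyticAt ℂ f (diag p, 0) := h.analyticAt.comp_of_eq hin (by simp)
  have hline : HasDerivAt (fun s : ℂ => f (diag p, s)) (fderiv ℂ R (diag p) (0, e)) 0 := by
    have h1 : HasDerivAt (fun s : ℂ => diag p + s • ((0, e) : CVec n)) (0, e) 0 := by
      simpa using ((hasDerivAt_id (0 : ℂ)).smul_const ((0, e) : CVec n)).const_add (diag p)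
    exact HasFDerivAt.comp_hasDerivAt_of_eq (0 : ℂ) h.analyticAt.differentiableAt.hasFDerivAt h1
      (by simp)
  have hline' : HasDerivAt (fun s : ℂ => f (diag p, s)) (fderiv ℂ f (diag p, 0) (0, 1)) 0 :=
    HasFDerivAt.comp_hasDerivAt (0 : ℂ) hfa.differentiableAt.hasFDerivAt
      ((hasDerivAt_const (0 : ℂ) (diag p)).prodMk (hasDerivAt_id 0))
  have hne : fderiv ℂ f (diag p, 0) (0, 1) ≠ 0 := by rwa [hline'.unique hline]
  have hf0 : f (diag p, 0) = 0 := by simpa only [hf, zero_smul, add_zero] using hRP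
  obtain ⟨Θ, h1, h2, h3, h4⟩ := exists_analyticAt_implicit hfa hne
  rw [hf0] at h3 h4
  refine ⟨Θ, h1, h2, h3, ?_⟩
  -- Uniqueness in the implicit function theorem, read at the value `0` of the unknown: `y` itself
  -- solves `R = 0` exactly if `Θ y = 0`.
  have ht : Tendsto (fun y : CVec n => (y, (0 : ℂ))) (𝓝 (diag p)) (𝓝 (diag p, 0)) :=
    (Continuous.prodMk_left (0 : ℂ)).tendsto _
  filter_upwards [ht.eventually h4] with y hy
  simpa only [hf, zero_smul, add_zero] using hy

namespace IsSegreSolution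

variable {e : Fin n → ℂ} {Θ : CVec n → ℂ}

lemma tendsto (hΘ : IsSegreSolution R p e Θ) :
    Tendsto (fun y => y + Θ y • ((0, e) : CVec n)) (𝓝 (diag p)) (𝓝 (diag p)) := by
  have h1 : ContinuousAt (fun y => y + Θ y • ((0, e) : CVec n)) (diag p) :=
    continuousAt_id.add (hΘ.analyticAt.continuousAt.smul continuousAt_const)
  rw [ContinuousAt, hΘ.apply_self] at h1
  simpa using h1

lemma hasFDerivAt (hΘ : IsSegreSolution R p e Θ) :
    ∀ᶠ y in 𝓝 (diag p), HasFDerivAt (fun y => y + Θ y • ((0, e) : CVec n))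
      (ContinuousLinearMap.id ℂ (CVec n) + (fderiv ℂ Θ y).smulRight (0, e)) y := by
  filter_upwards [hΘ.analyticAt.eventually_analyticAt] with y hy
  exact (hasFDerivAt_id y).add (hy.differentiableAt.hasFDerivAt.smul_const _)

/-- Differentiating `R(y + Θ(y) (0, e)) = 0`. -/
lemma fderiv_add (hΘ : IsSegreSolution R p e Θ) (h : IsDefiningAt M R p) :
    ∀ᶠ y in 𝓝 (diag p), ∀ v, fderiv ℂ R (y + Θ y • (0, e)) v +
      fderiv ℂ Θ y v * fderiv ℂ R (y + Θ y • (0, e)) (0, e) = 0 := by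
  filter_upwards [hΘ.hasFDerivAt, eventually_eventually_nhds.2 hΘ.solves,
    hΘ.tendsto.eventually h.analyticAt.eventually_analyticAt] with y h1 h2 h3 v
  have h4 := (h3.differentiableAt.hasFDerivAt.comp y h1).unique
    ((hasFDerivAt_const (0 : ℂ) y).congr_of_eventuallyEq h2)
  have h5 : fderiv ℂ R (y + Θ y • (0, e)) (v + fderiv ℂ Θ y v • ((0, e) : CVec n)) = 0 :=
    congrArg (fun A => A v) h4
  rwa [map_add, map_smul, smul_eq_mul] at h5

end IsSegreSolution

/-- A real-analytic CR field `K` of type `(1,0)` tangent to `M` extends to a holomorphic field,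
which is tangent to all Segre varieties. -/
lemma IsDefiningAt.exists_holomorphic_extension (h : IsDefiningAt M R p) (hp : p ∈ M)
    {e : Fin n → ℂ} (he : fderiv ℂ R (diag p) (0, e) ≠ 0) {Θ : CVec n → ℂ}
    (hΘ : IsSegreSolution R p e Θ) {K : (Fin n → ℂ) → Fin n → ℂ} (hK : AnalyticAt ℝ K p)
    (hKtan : ∀ᶠ q in 𝓝[M] p, (K q, 0) ∈ complexTangent M q)
    (hKCR : ∀ᶠ q in 𝓝[M] p, ∀ w ∈ T01 M q, ∀ i, along w (fun x => K x i) q = 0)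
    {j : Fin n} (hKj : ∀ᶠ q in 𝓝 p, K q j = 1) :
    ∃ k : (Fin n → ℂ) → Fin n → ℂ, AnalyticAt ℂ k p ∧ (∀ᶠ z in 𝓝 p, k z j = 1) ∧
      ∀ᶠ y in 𝓝 (diag p), fderiv ℂ Θ y (k y.1, 0) = 0 := by
  obtain ⟨g, hg, hgK⟩ := exists_complexification hK
  have hR' := h.analyticAt.fderiv
  have hgj : ∀ᶠ y in 𝓝 (diag p), g y j = 1 := by
    have hd : ∀ᶠ y in 𝓝 (diag p), DifferentiableAt ℂ (fun y => g y j - 1) y := by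
      filter_upwards [hg.eventually_analyticAt] with y hy
      exact (differentiableAt_pi.1 hy.differentiableAt j).sub_const 1
    filter_upwards [eventually_eq_zero_of_diag hd
      (by filter_upwards [hgK, hKj] with q h1 h2; rw [h1, h2, sub_self])] with y hy
    exact sub_eq_zero.1 hy
  -- `g` is tangent to `{R = 0}`
  have htan : ∀ᶠ y in 𝓝 (diag p), R y = 0 → fderiv ℂ R y (g y, 0) = 0 := by
    refine h.eventually_eq_zero hp (H := fun y => fderiv ℂ R y (g y, 0))
      (analyticAt_clm_apply hR' (hg.prod analyticAt_const)) ?_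
    filter_upwards [hKtan, self_mem_nhdsWithin, h.eventually.filter_mono nhdsWithin_le_nhds,
      hgK.filter_mono nhdsWithin_le_nhds] with q h1 h2 h3 h4
    rw [h4]
    exact (h3.mem_complexTangent h2).1 h1
  -- `g` is constant along the fibres of `{R = 0}` over the first factor
  have hCR : ∀ᶠ y in 𝓝 (diag p), R y = 0 → ∀ b, fderiv ℂ R y (0, b) = 0 →
      fderiv ℂ g y (0, b) = 0 := by
    -- The CR equations of `K`, on the explicit (0,1)-fields `R_e ∂/∂z̄_i - R_i ∂_ē`, are polarized
    -- to identities on `{R = 0}`, where `R_e` and `R_i` are the derivatives of `R` along `(0, e)`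
    -- and the `i`-th `ζ`-direction.
    have h1 : ∀ i : Fin n, ∀ᶠ y in 𝓝 (diag p), R y = 0 →
        fderiv ℂ R y (0, e) • fderiv ℂ g y (0, Pi.single i 1) -
          fderiv ℂ R y (0, Pi.single i 1) • fderiv ℂ g y (0, e) = 0 := fun i => by
      refine h.eventually_eq_zero hp (H := fun y =>
        fderiv ℂ R y (0, e) • fderiv ℂ g y (0, Pi.single i 1) -
          fderiv ℂ R y (0, Pi.single i 1) • fderiv ℂ g y (0, e)) ?_ ?_
      · exact ((analyticAt_clm_apply hR' analyticAt_const).smul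
          (analyticAt_clm_apply hg.fderiv analyticAt_const)).sub
          ((analyticAt_clm_apply hR' analyticAt_const).smul
          (analyticAt_clm_apply hg.fderiv analyticAt_const))
      · have hdt : Tendsto (fun q => diag q) (𝓝 p) (𝓝 (diag p)) := diag.continuous.tendsto p
        filter_upwards [hKCR, self_mem_nhdsWithin, h.eventually.filter_mono nhdsWithin_le_nhds,
          (eventually_eventually_nhds.2 hgK).filter_mono nhdsWithin_le_nhds,
          (hdt.eventually hg.eventually_analyticAt).filter_mono nhdsWithin_le_nhds]
          with q h1 h2 h3 h4 h5
        set A := fderiv ℂ R (diag q)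
        have hw : A (0, e) • ((0, Pi.single i 1) : CVec n) - A (0, Pi.single i 1) • (0, e) ∈
            T01 M q := by
          rw [mem_T01, h3.mem_complexTangent h2]
          refine ⟨by simp, ?_⟩
          rw [map_sub, map_smul, map_smul]
          simp only [smul_eq_mul, A]
          ring
        rw [← map_smul, ← map_smul, ← map_sub]
        funext l
        have h6 := h1 _ hw l
        have h7 : HasFDerivAt (fun y => g y l) ((ContinuousLinearMap.proj (R := ℂ) l).comp
            (fderiv ℂ g (diag q))) (diag q) :=
          (ContinuousLinearMap.proj (R := ℂ) (φ := fun _ : Fin n => ℂ) l).hasFDerivAt.comp _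
            h5.differentiableAt.hasFDerivAt
        rw [along_eq_fderiv h7.differentiableAt
          (by filter_upwards [h4] with x hx; rw [hx]), h7.fderiv] at h6
        exact h6
    have hne : ∀ᶠ y in 𝓝 (diag p), fderiv ℂ R y (0, e) ≠ 0 :=
      (analyticAt_clm_apply hR' analyticAt_const).continuousAt.eventually_ne he
    filter_upwards [eventually_all.2 h1, hne] with y h2 h3 h4 b h5
    have hb : ((0, b) : CVec n) = ∑ i, b i • (0, Pi.single i 1) := by
      ext i <;> simp [Finset.sum_apply, Prod.fst_sum, Prod.snd_sum, Pi.single_apply]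
    have h6 : fderiv ℂ R y (0, e) • fderiv ℂ g y (0, b) -
        fderiv ℂ R y (0, b) • fderiv ℂ g y (0, e) = 0 := by
      have : ∑ i, b i • (fderiv ℂ R y (0, e) • fderiv ℂ g y (0, Pi.single i 1) -
          fderiv ℂ R y (0, Pi.single i 1) • fderiv ℂ g y (0, e)) = 0 :=
        Finset.sum_eq_zero fun i _ => by rw [h2 i h4, smul_zero]
      refine Eq.trans ?_ this
      rw [hb, map_sum, map_sum, Finset.smul_sum, Finset.sum_smul, ← Finset.sum_sub_distrib]
      refine Finset.sum_congr rfl fun i _ => ?_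
      rw [map_smul, map_smul, smul_sub, smul_comm, smul_assoc]
    rw [h5, zero_smul, sub_zero] at h6
    exact (smul_eq_zero.1 h6).resolve_left h3
  -- `S` moves a neighbourhood onto `{R = 0}` without changing `z`, so `g ∘ S` is defined off the
  -- hypersurface too.
  set S : CVec n → CVec n := fun y => y + Θ y • ((0, e) : CVec n) with hS
  have hSt : Tendsto S (𝓝 (diag p)) (𝓝 (diag p)) := hΘ.tendsto
  have hSP : S (diag p) = diag p := by simp [hS, hΘ.apply_self]
  have hSan : AnalyticAt ℂ S (diag p) :=
    analyticAt_id.add (hΘ.analyticAt.smul analyticAt_const)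
  have hgS : AnalyticAt ℂ (fun y => g (S y)) (diag p) := hg.comp_of_eq hSan hSP
  -- The differential of `S` sends `(0, b)` to a vector `(0, b')` tangent to `{R = 0}`, along which
  -- `g` is constant.
  have hconst : ∀ᶠ y in 𝓝 (diag p), ∀ b, fderiv ℂ (fun y => g (S y)) y (0, b) = 0 := by
    filter_upwards [hΘ.hasFDerivAt, hΘ.fderiv_add h, hSt.eventually hCR, hΘ.solves,
      hSt.eventually hg.eventually_analyticAt] with y h1 h2 h3 h4 h5 b
    have h6 := h5.differentiableAt.hasFDerivAt.comp y h1
    have h7 : fderiv ℂ (fun y => g (S y)) y = _ := h6.fderiv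
    rw [h7]
    have h8 : (ContinuousLinearMap.id ℂ (CVec n) +
        (fderiv ℂ Θ y).smulRight ((0, e) : CVec n)) ((0, b) : CVec n) =
        ((0, b + fderiv ℂ Θ y (0, b) • e) : CVec n) := by
      ext i <;> simp
    have h9 : ((0, b + fderiv ℂ Θ y (0, b) • e) : CVec n) =
        (0, b) + fderiv ℂ Θ y (0, b) • (0, e) := by
      ext i <;> simp
    rw [ContinuousLinearMap.comp_apply, h8]
    refine h3 h4 _ ?_
    rw [h9, map_add, map_smul, smul_eq_mul]
    exact h2 (0, b)
  have hfib : ∀ᶠ y in 𝓝 (diag p), g (S y) = g (S (y.1, star p)) := by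
    obtain ⟨ε, hε, hball⟩ := Metric.eventually_nhds_iff_ball.1 (hconst.and
      hgS.eventually_analyticAt)
    filter_upwards [Metric.ball_mem_nhds (diag p) hε] with y hy
    have hmem : ∀ ζ ∈ Metric.ball (star p) ε, ((y.1, ζ) : CVec n) ∈ Metric.ball (diag p) ε := by
      intro ζ hζ
      rw [diag_apply, ← ball_prod_same] at hy ⊢
      exact ⟨hy.1, hζ⟩
    have hd : ∀ ζ ∈ Metric.ball (star p) ε, HasFDerivAt (fun ζ => g (S (y.1, ζ)))
        (0 : (Fin n → ℂ) →L[ℂ] Fin n → ℂ) ζ := fun ζ hζ => by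
      obtain ⟨h1, h2⟩ := hball _ (hmem ζ hζ)
      have h3 := h2.differentiableAt.hasFDerivAt.comp ζ
        ((hasFDerivAt_const y.1 ζ).prodMk (hasFDerivAt_id ζ))
      refine h3.congr_fderiv (ContinuousLinearMap.ext fun b => ?_)
      simpa using h1 b
    have hy2 : y.2 ∈ Metric.ball (star p) ε := by
      rw [diag_apply, ← ball_prod_same] at hy
      exact hy.2
    exact Metric.isOpen_ball.is_const_of_fderiv_eq_zero (𝕜 := ℂ)
      (f := fun ζ => g (S (y.1, ζ)))
      (convex_ball _ _).isPreconnected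
      (fun ζ hζ => (hd ζ hζ).differentiableAt.differentiableWithinAt)
      (fun ζ hζ => (hd ζ hζ).fderiv) hy2 (Metric.mem_ball_self hε)
  have hpt : AnalyticAt ℂ (fun z : Fin n → ℂ => ((z, star p) : CVec n)) p :=
    analyticAt_id.prod analyticAt_const
  -- As `g ∘ S` does not depend on `ζ`, freezing `ζ = p̄` loses nothing. Tangency of `g` at `S y`
  -- then makes `dΘ(k, 0)` vanish at every nearby `y`, not only on `{R = 0}`.
  refine ⟨fun z => g (S (z, star p)), hgS.comp_of_eq hpt rfl, ?_, ?_⟩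
  · exact (hSt.comp (hpt.continuousAt.tendsto)).eventually hgj
  · have hne : ∀ᶠ y in 𝓝 (diag p), fderiv ℂ R y (0, e) ≠ 0 :=
      (analyticAt_clm_apply hR' analyticAt_const).continuousAt.eventually_ne he
    filter_upwards [hfib, hΘ.fderiv_add h, hΘ.solves, hSt.eventually htan,
      hSt.eventually hne] with y h1 h2 h3 h4 h5
    rw [← h1]
    have h6 := h2 (g (S y), 0)
    rw [h4 h3, zero_add] at h6
    exact (mul_eq_zero.1 h6).resolve_right h5

end CRGeom

namespace CRGeom

variable {n : ℕ}

/-! ### Straightening coordinates -/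

/-- Shrinks a chart so that a local condition holds on the whole target. The norm on `Fin n → ℂ` is
the sup norm, so the target is a polydisc, in which one coordinate can be varied or set to its
central value. -/
lemma exists_restr_ball {p : Fin n → ℂ} (h : OpenPartialHomeomorph (Fin n → ℂ) (Fin n → ℂ))
    (hp : p ∈ h.source) {T : (Fin n → ℂ) → Prop} (hT : ∀ᶠ c in 𝓝 (h p), T c) :
    ∃ h' : OpenPartialHomeomorph (Fin n → ℂ) (Fin n → ℂ), ⇑h' = h ∧ ⇑h'.symm = h.symm ∧
      p ∈ h'.source ∧ h'.source ⊆ h.source ∧ ∃ ε > 0, h'.target = Metric.ball (h p) ε ∧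
        ∀ c ∈ h'.target, c ∈ h.target ∧ T c := by
  obtain ⟨ε, hε, hb⟩ := Metric.eventually_nhds_iff_ball.1
    (hT.and (h.open_target.mem_nhds (h.map_source hp)))
  have htgt : h.target ∩ interior (Metric.ball (h p) ε) = Metric.ball (h p) ε := by
    rw [Metric.isOpen_ball.interior_eq]
    exact Set.inter_eq_right.2 fun c hc => (hb c hc).2
  refine ⟨(h.symm.restr (Metric.ball (h p) ε)).symm, rfl, rfl, ?_, ?_, ε, hε, htgt, ?_⟩
  · rw [OpenPartialHomeomorph.symm_source, OpenPartialHomeomorph.restr_target]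
    exact ⟨hp, by simpa [Metric.isOpen_ball.interior_eq] using hε⟩
  · rw [OpenPartialHomeomorph.symm_source, OpenPartialHomeomorph.restr_target]
    exact Set.inter_subset_left
  · intro c hc
    have hc' : c ∈ Metric.ball (h p) ε := by rwa [← htgt]
    exact ⟨(hb c hc').2, (hb c hc').1⟩

/-- The holomorphic inverse function theorem. -/
lemma exists_isBiholomorphism {f : (Fin n → ℂ) → Fin n → ℂ} {p : Fin n → ℂ}
    (hf : AnalyticAt ℂ f p) (hinj : ∀ a, fderiv ℂ f p a = 0 → a = 0) :
    ∃ h : OpenPartialHomeomorph (Fin n → ℂ) (Fin n → ℂ), IsBiholomorphism h ∧ p ∈ h.source ∧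
      ⇑h = f := by
  let i : (Fin n → ℂ) ≃L[ℂ] (Fin n → ℂ) := (LinearEquiv.ofInjectiveEndo
    (fderiv ℂ f p).toLinearMap (LinearMap.ker_eq_bot.1
      (LinearMap.ker_eq_bot'.2 hinj))).toContinuousLinearEquiv
  have hi : HasFDerivAt f (i : (Fin n → ℂ) →L[ℂ] (Fin n → ℂ)) p :=
    hf.differentiableAt.hasFDerivAt.congr_fderiv (by ext; rfl)
  have hc : ContDiffAt ℂ ω f p := hf.contDiffAt
  let h₀ := hc.toOpenPartialHomeomorph f hi (by simp)
  have hp : p ∈ h₀.source := hc.mem_toOpenPartialHomeomorph_source hi (by simp)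
  have hsymm : AnalyticAt ℂ h₀.symm (h₀ p) := (hc.to_localInverse hi (by simp)).analyticAt
  have hback : ∀ᶠ c in 𝓝 (h₀ p), AnalyticAt ℂ f (h₀.symm c) := by
    have ht : Tendsto h₀.symm (𝓝 (h₀ p)) (𝓝 p) := by
      have := hsymm.continuousAt.tendsto
      rwa [h₀.left_inv hp] at this
    exact ht.eventually hf.eventually_analyticAt
  obtain ⟨h, h1, h2, h3, h4, ε, hε, h5, h6⟩ := exists_restr_ball h₀ hp
    (hsymm.eventually_analyticAt.and hback)
  refine ⟨h, ⟨fun z hz => ?_, fun c hc => ?_⟩, h3, h1⟩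
  · have h7 := (h6 _ (h.map_source hz)).2.2
    rw [h1, h₀.left_inv (h4 hz)] at h7
    rw [h1]
    exact h7
  · rw [h2]
    exact (h6 c hc).2.1

variable {M : Set (Fin 3 → ℂ)} {R : CVec 3 → ℂ} {p e b : Fin 3 → ℂ} {Θ : CVec 3 → ℂ}

/-- Two independent first integrals of `k`, and a coordinate transverse to them. -/
def straightening (Θ : CVec 3 → ℂ) (p b : Fin 3 → ℂ) (j : Fin 3) (c : ℂ) (z : Fin 3 → ℂ) :
    Fin 3 → ℂ :=
  ![fderiv ℂ Θ (z, star p) (0, b), z j - p j, c * Θ (z, star p)]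

lemma hasFDerivAt_mk_left {F : Type*} [NormedAddCommGroup F] [NormedSpace ℂ F] {g : CVec n → F}
    {z ζ : Fin n → ℂ} (hg : DifferentiableAt ℂ g (z, ζ)) :
    HasFDerivAt (fun z => g (z, ζ)) ((fderiv ℂ g (z, ζ)).comp (.inl ℂ _ _)) z :=
  hg.hasFDerivAt.comp z (hasFDerivAt_prodMk_left z ζ)

lemma hasFDerivAt_straightening {z : Fin 3 → ℂ} (hΘ : AnalyticAt ℂ Θ (z, star p)) (j : Fin 3)
    (c : ℂ) : DifferentiableAt ℂ (straightening Θ p b j c) z ∧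
      ∀ a, fderiv ℂ (straightening Θ p b j c) z a =
        ![fderiv ℂ (fderiv ℂ Θ) (z, star p) (a, 0) (0, b), a j,
          c * fderiv ℂ Θ (z, star p) (a, 0)] := by
  have h0 : HasFDerivAt (fun z => fderiv ℂ Θ (z, star p) (0, b)) _ z :=
    (hasFDerivAt_mk_left hΘ.fderiv.differentiableAt).clm_apply
      (hasFDerivAt_const ((0, b) : CVec 3) z)
  have h1 : HasFDerivAt (fun z : Fin 3 → ℂ => z j - p j) _ z :=
    ((ContinuousLinearMap.proj (R := ℂ) (φ := fun _ : Fin 3 => ℂ) j).hasFDerivAt).sub_const (p j)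
  have h2 : HasFDerivAt (fun z => c * Θ (z, star p)) _ z :=
    (hasFDerivAt_mk_left hΘ.differentiableAt).const_mul c
  have h : ∀ i, HasFDerivAt (fun z => straightening Θ p b j c z i)
      (![_, _, _] i : (Fin 3 → ℂ) →L[ℂ] ℂ) z := fun i => by
    fin_cases i
    · exact h0
    · exact h1
    · exact h2
  have h' := hasFDerivAt_pi.2 h
  refine ⟨h'.differentiableAt, fun a => ?_⟩
  have h3 : fderiv ℂ (straightening Θ p b j c) z = _ := h'.fderiv
  rw [h3]
  funext i
  fin_cases i <;> simp

lemma analyticAt_straightening (hΘ : AnalyticAt ℂ Θ (diag p)) (j : Fin 3) (c : ℂ) :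
    AnalyticAt ℂ (straightening Θ p b j c) p := by
  have hpt : AnalyticAt ℂ (fun z : Fin 3 → ℂ => ((z, star p) : CVec 3)) p :=
    analyticAt_id.prod analyticAt_const
  refine analyticAt_pi_iff.2 fun i => ?_
  fin_cases i
  · exact (analyticAt_clm_apply hΘ.fderiv analyticAt_const).comp_of_eq hpt rfl
  · exact ((ContinuousLinearMap.proj (R := ℂ) (φ := fun _ : Fin 3 => ℂ) j).analyticAt p).sub
      analyticAt_const
  · exact analyticAt_const.mul (hΘ.comp_of_eq hpt rfl)

/-- At the base point, `D²Θ(u)(0, b)` is a multiple of `D²R(u)(0, b)` for the directions `u` which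
are tangent to `{Θ = 0}`. -/
lemma IsSegreSolution.hessian (hΘ : IsSegreSolution R p e Θ) (h : IsDefiningAt M R p)
    (he : fderiv ℂ R (diag p) (0, e) ≠ 0)
    (hb : fderiv ℂ R (diag p) (0, b) = 0) {u : CVec 3} (hu : fderiv ℂ Θ (diag p) u = 0) :
    fderiv ℂ (fderiv ℂ R) (diag p) u (0, b) +
      fderiv ℂ (fderiv ℂ Θ) (diag p) u (0, b) * fderiv ℂ R (diag p) (0, e) = 0 := by
  have hSP : diag p + Θ (diag p) • ((0, e) : CVec 3) = diag p := by
    rw [hΘ.apply_self, zero_smul, add_zero]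
  have hΘb : fderiv ℂ Θ (diag p) (0, b) = 0 := by
    have := (hΘ.fderiv_add h).self_of_nhds (0, b)
    rw [hSP, hb, zero_add] at this
    exact (mul_eq_zero.1 this).resolve_right he
  have hS := hΘ.hasFDerivAt.self_of_nhds
  have hR' : HasFDerivAt (fun y => fderiv ℂ R (y + Θ y • ((0, e) : CVec 3))) _ (diag p) :=
    HasFDerivAt.comp (g := fderiv ℂ R) (g' := fderiv ℂ (fderiv ℂ R) (diag p)) (diag p)
      (by rw [hSP]; exact h.analyticAt.fderiv.differentiableAt.hasFDerivAt) hS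
  have h1 := hR'.clm_apply (hasFDerivAt_const ((0, b) : CVec 3) (diag p))
  have h2 := hΘ.analyticAt.fderiv.differentiableAt.hasFDerivAt.clm_apply
    (hasFDerivAt_const ((0, b) : CVec 3) (diag p))
  have h3 := hR'.clm_apply (hasFDerivAt_const ((0, e) : CVec 3) (diag p))
  -- Differentiate the identity of `fderiv_add` once more. At the base point `dΘ(0, b) = 0` removes
  -- one product term, and `dΘ(u) = 0` means that `S(y) = y + Θ(y)(0, e)` has derivative `u` along
  -- `u`.
  have h4 := (h1.add (h2.mul h3)).unique ((hasFDerivAt_const (0 : ℂ) (diag p)).congr_of_eventuallyEq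
    (by filter_upwards [hΘ.fderiv_add h] with y hy using hy (0, b)))
  have h5 := congrArg (fun A => A u) h4
  simp only [hSP, hΘb] at h5
  simpa [hu, mul_comm] using h5

end CRGeom

/-! ### Invariance of `M` along the straightened field. -/

namespace CRGeom

variable {M : Set (Fin 3 → ℂ)} {R : CVec 3 → ℂ} {p e b : Fin 3 → ℂ} {Θ : CVec 3 → ℂ}

/-- Differentiate `dΘ(k(z), 0) = 0` in the direction `(0, b)`: since `k` depends on `z` alone, only
`dΘ` is differentiated, so `∂_b Θ` is a first integral of `k` just as `Θ` is. The middle coordinate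
has derivative `k_j = 1`. -/
lemma fderiv_straightening_apply {k : (Fin 3 → ℂ) → Fin 3 → ℂ} {j : Fin 3} {z : Fin 3 → ℂ}
    (hΘ : AnalyticAt ℂ Θ (z, star p)) (hk : DifferentiableAt ℂ k z) (hkj : k z j = 1)
    (hkΘ : ∀ᶠ y in 𝓝 (z, star p), fderiv ℂ Θ y (k y.1, 0) = 0) (c : ℂ) :
    fderiv ℂ (straightening Θ p b j c) z (k z) = Pi.single 1 1 := by
  rw [(hasFDerivAt_straightening hΘ j c).2]
  have h1 : fderiv ℂ (fderiv ℂ Θ) (z, star p) (k z, 0) (0, b) = 0 := by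
    have hsymm := (hΘ.contDiffAt (n := ω)).isSymmSndFDerivAt_of_omega (k z, 0) (0, b)
    rw [hsymm]
    have h2 : HasFDerivAt (fun y : CVec 3 => ((k y.1, 0) : CVec 3)) _ (z, star p) :=
      (HasFDerivAt.comp (g := k) (z, star p) hk.hasFDerivAt hasFDerivAt_fst).prodMk
        (hasFDerivAt_const (0 : Fin 3 → ℂ) (z, star p))
    have h3 := (hΘ.fderiv.differentiableAt.hasFDerivAt.clm_apply h2).unique
      ((hasFDerivAt_const (0 : ℂ) (z, star p)).congr_of_eventuallyEq hkΘ)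
    have h4 : fderiv ℂ Θ (z, star p) ((0 : Fin 3 → ℂ), (0 : Fin 3 → ℂ)) = 0 := map_zero _
    simpa [h4] using congrArg (fun A => A (0, b)) h3
  rw [h1, hkj, hkΘ.self_of_nhds, mul_zero]
  ext i
  fin_cases i <;> simp

/-- A function killed by the field `∂/∂c₁` on a ball does not depend on `c₁`. -/
lemma eq_of_fderiv_single_eq_zero {F : (Fin 3 → ℂ) → ℂ} {ε : ℝ}
    (hF : ∀ c ∈ Metric.ball (0 : Fin 3 → ℂ) ε, DifferentiableAt ℂ F c ∧
      fderiv ℂ F c (Pi.single 1 1) = 0) {c c' : Fin 3 → ℂ} (hc : c ∈ Metric.ball 0 ε)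
    (hc' : c' ∈ Metric.ball 0 ε) (h0 : c 0 = c' 0) (h2 : c 2 = c' 2) : F c = F c' := by
  have hε : 0 < ε := (norm_nonneg c).trans_lt (mem_ball_zero_iff.1 hc)
  have hmem : ∀ s ∈ Metric.ball (0 : ℂ) ε, Function.update c 1 s ∈ Metric.ball 0 ε := by
    intro s hs
    rw [mem_ball_zero_iff, pi_norm_lt_iff hε] at hc ⊢
    intro i
    by_cases hi : i = 1
    · subst hi; simpa using hs
    · simpa [hi] using hc i
  have hd : ∀ s ∈ Metric.ball (0 : ℂ) ε, HasDerivAt (fun s => F (Function.update c 1 s)) 0 s := by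
    intro s hs
    obtain ⟨h3, h4⟩ := hF _ (hmem s hs)
    have := h3.hasFDerivAt.comp_hasDerivAt s (hasDerivAt_update c 1 s)
    rwa [h4] at this
  have hcomp : ∀ {x : Fin 3 → ℂ}, x ∈ Metric.ball 0 ε → x 1 ∈ Metric.ball (0 : ℂ) ε := fun hx =>
    mem_ball_zero_iff.2 ((pi_norm_lt_iff hε).1 (mem_ball_zero_iff.1 hx) 1)
  have key : F (Function.update c 1 (c 1)) = F (Function.update c 1 (c' 1)) :=
    Metric.isOpen_ball.is_const_of_deriv_eq_zero (f := fun s => F (Function.update c 1 s))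
      (convex_ball _ _).isPreconnected
      (fun s hs => (hd s hs).differentiableAt.differentiableWithinAt)
      (fun s hs => (hd s hs).deriv) (hcomp hc) (hcomp hc')
  rw [Function.update_eq_self] at key
  rw [key]
  congr 1
  ext i
  fin_cases i <;> simp [h0, h2]

/-- Coordinates in which `M` is invariant under translations in the second variable. -/
lemma IsSegreSolution.exists_straightening (hΘ : IsSegreSolution R p e Θ)
    (h : IsDefiningAt M R p) (he : fderiv ℂ R (diag p) (0, e) ≠ 0)
    {k : (Fin 3 → ℂ) → Fin 3 → ℂ} {j : Fin 3} (hk : AnalyticAt ℂ k p)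
    (hkj : ∀ᶠ z in 𝓝 p, k z j = 1)
    (hkΘ : ∀ᶠ y in 𝓝 (diag p), fderiv ℂ Θ y (k y.1, 0) = 0)
    (hb : fderiv ℂ R (diag p) (0, b) = 0)
    (hnd : ∀ a, fderiv ℂ R (diag p) (a, 0) = 0 →
      fderiv ℂ (fderiv ℂ R) (diag p) (0, b) (a, 0) = 0 → a j = 0 → a = 0) :
    ∃ f : OpenPartialHomeomorph (Fin 3 → ℂ) (Fin 3 → ℂ), IsBiholomorphism f ∧ p ∈ f.source ∧
      f p = 0 ∧ (∀ w, fderiv ℂ R (diag p) (fderiv ℂ f.symm 0 w, 0) = Complex.I * w 2) ∧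
      ∃ ε > 0, f.target = Metric.ball 0 ε ∧ ∀ c ∈ f.target, ∀ c' ∈ f.target, c 0 = c' 0 →
        c 2 = c' 2 → (f.symm c ∈ M ↔ f.symm c' ∈ M) := by
  set d := fderiv ℂ R (diag p) (0, e) with hd
  -- As `dR = -d · dΘ` at the base point, the factor `i d` makes `dR` on (1,0)-vectors equal to `i`
  -- times the last coordinate, as is needed for `dφ(0) = 0`.
  set st := straightening Θ p b j (Complex.I * d) with hst
  have hRΘ : ∀ v, fderiv ℂ R (diag p) v + fderiv ℂ Θ (diag p) v * d = 0 := by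
    have := (hΘ.fderiv_add h).self_of_nhds
    rwa [hΘ.apply_self, zero_smul, add_zero] at this
  have hstan : AnalyticAt ℂ st p := analyticAt_straightening hΘ.analyticAt j _
  have hst' : ∀ a, fderiv ℂ st p a = ![fderiv ℂ (fderiv ℂ Θ) (diag p) (a, 0) (0, b), a j,
      Complex.I * d * fderiv ℂ Θ (diag p) (a, 0)] :=
    (hasFDerivAt_straightening hΘ.analyticAt j _).2
  -- A vector killed by `d st` is tangent, Levi-orthogonal to the chosen direction by
  -- `IsSegreSolution.hessian`, and has zero `j`-th coefficient, so `hnd` applies.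
  have hinj : ∀ a, fderiv ℂ st p a = 0 → a = 0 := fun a ha => by
    rw [hst'] at ha
    have h0 : fderiv ℂ (fderiv ℂ Θ) (diag p) (a, 0) (0, b) = 0 := congrFun ha 0
    have h1 : a j = 0 := congrFun ha 1
    have h2 : Complex.I * d * fderiv ℂ Θ (diag p) (a, 0) = 0 := congrFun ha 2
    have h3 : fderiv ℂ Θ (diag p) (a, 0) = 0 :=
      (mul_eq_zero.1 h2).resolve_left (mul_ne_zero Complex.I_ne_zero he)
    have h4 := hΘ.hessian h he hb h3
    rw [h0, zero_mul, add_zero, h.hessian_symm] at h4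
    have h5 := hRΘ (a, 0)
    rw [h3, zero_mul, add_zero] at h5
    exact hnd a h5 h4 h1
  obtain ⟨f₀, hf₀, hpf₀, hf₀st⟩ := exists_isBiholomorphism hstan hinj
  have hstp : st p = 0 := by
    have h1 : Θ (p, star p) = 0 := hΘ.apply_self
    have h2 : fderiv ℂ Θ (p, star p) (0, b) = 0 := by
      have := hRΘ (0, b)
      rw [hb, zero_add] at this
      exact (mul_eq_zero.1 this).resolve_right he
    ext i
    fin_cases i <;> simp [hst, straightening, h1, h2]
  have hf₀p : f₀ p = 0 := by rw [hf₀st, hstp]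
  obtain ⟨δ, hδ, hball⟩ := Metric.eventually_nhds_iff_ball.1
    ((hΘ.eq_zero_iff.and h.eventually_conjVec).and (hΘ.analyticAt.eventually_analyticAt.and hkΘ))
  have hsymm : AnalyticAt ℂ f₀.symm (f₀ p) := hf₀.2 _ (f₀.map_source hpf₀)
  have ht : Tendsto f₀.symm (𝓝 (f₀ p)) (𝓝 p) := by
    have := hsymm.continuousAt.tendsto
    rwa [f₀.left_inv hpf₀] at this
  obtain ⟨f, hff₀, hfsymm, hpf, hfs, ε, hε, hft, hT⟩ := exists_restr_ball f₀ hpf₀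
    (ht.eventually (((Metric.isOpen_ball.eventually_mem (Metric.mem_ball_self hδ)).and h.mem_iff).and
      (hkj.and hk.eventually_analyticAt)))
  have hst_symm : ∀ c ∈ f.target, st (f.symm c) = c := fun c hc => by
    rw [← hf₀st, ← hff₀, f.right_inv hc]
  have hpair : ∀ {z z' : Fin 3 → ℂ}, z ∈ Metric.ball p δ → z' ∈ Metric.ball p δ →
      ((z, star z') : CVec 3) ∈ Metric.ball (diag p) δ := fun hz hz' => by
    rw [diag_apply, ← ball_prod_same]
    refine ⟨hz, ?_⟩
    rw [Metric.mem_ball, dist_eq_norm] at hz' ⊢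
    rwa [← star_sub, norm_star]
  have hpp : p ∈ Metric.ball p δ := Metric.mem_ball_self hδ
  -- the inverse coordinates straighten `k`
  have hsymm' : ∀ c ∈ f.target, HasFDerivAt f.symm (fderiv ℂ f.symm c) c ∧
      fderiv ℂ f.symm c (Pi.single 1 1) = k (f.symm c) := fun c hc => by
    obtain ⟨hc0, ⟨hz, -⟩, hzj, hzk⟩ := hT c hc
    have hA : HasFDerivAt f.symm (fderiv ℂ f.symm c) c := by
      rw [hfsymm]
      exact (hf₀.2 c hc0).differentiableAt.hasFDerivAt
    refine ⟨hA, ?_⟩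
    set z := f₀.symm c with hzdef
    have hzc : f.symm c = z := by rw [hfsymm]
    have hcz : st z = c := by rw [← hzc]; exact hst_symm c hc
    have hmem := hpair hz hpp
    have hΘz := (hball _ hmem).2.1
    have h1 := (hasFDerivAt_straightening (b := b) hΘz j (Complex.I * d)).1.hasFDerivAt
    have h2 : HasFDerivAt (f.symm ∘ st) _ z := HasFDerivAt.comp z (by rw [hcz]; exact hA) h1
    have h3 : HasFDerivAt (f.symm ∘ st) (ContinuousLinearMap.id ℂ (Fin 3 → ℂ)) z := by
      refine (hasFDerivAt_id z).congr_of_eventuallyEq ?_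
      have hzs : z ∈ f.source := by rw [← hzc]; exact f.map_target hc
      filter_upwards [f.open_source.mem_nhds hzs] with x hx
      rw [Function.comp_apply, ← hf₀st, ← hff₀, f.left_inv hx]
      rfl
    have h4 := congrArg (fun A => A (k z)) (h2.unique h3)
    have h5 := fderiv_straightening_apply (b := b) hΘz hzk.differentiableAt hzj
      (by filter_upwards [Metric.isOpen_ball.mem_nhds hmem] with y hy using (hball y hy).2.2)
      (Complex.I * d)
    simp only [ContinuousLinearMap.comp_apply, h5] at h4
    rw [hzc]
    exact h4
  -- In the new coordinates `k` is `∂/∂c₁`, so the first integral `Θ(·, ζ̄)` does not depend on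
  -- `c₁`, for every `ζ` near `p`.
  have hconst : ∀ ζ ∈ Metric.ball p δ, ∀ c ∈ f.target, ∀ c' ∈ f.target, c 0 = c' 0 → c 2 = c' 2 →
      Θ (f.symm c, star ζ) = Θ (f.symm c', star ζ) := fun ζ hζ c hc c' hc' h0 h2 => by
    rw [hft, hf₀p] at hc hc'
    refine eq_of_fderiv_single_eq_zero (F := fun c => Θ (f.symm c, star ζ)) (ε := ε) ?_
      hc hc' h0 h2
    intro x hx
    have hx' : x ∈ f.target := by rwa [hft, hf₀p]
    obtain ⟨hA, hA1⟩ := hsymm' x hx'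
    have hz : f.symm x ∈ Metric.ball p δ := by
      rw [hfsymm]
      exact (hT x hx').2.1.1
    obtain ⟨-, h3, h4⟩ := hball _ (hpair hz hζ)
    have h5 := (hasFDerivAt_mk_left h3.differentiableAt).comp x hA
    refine ⟨h5.differentiableAt, ?_⟩
    have h6 : fderiv ℂ (fun c => Θ (f.symm c, star ζ)) x = _ := h5.fderiv
    rw [h6]
    simpa [hA1] using h4
  refine ⟨f, ⟨fun z hz => ?_, fun c hc => ?_⟩, hpf, by rw [hff₀, hf₀p], fun w => ?_, ε, hε,
    by rw [hft, hf₀p], fun c hc c' hc' h0 h2 => ?_⟩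
  · rw [hff₀]
    exact hf₀.1 z (hfs hz)
  · rw [hfsymm]
    exact hf₀.2 c (hT c hc).1
  · have h0t : (0 : Fin 3 → ℂ) ∈ f.target := by
      rw [hft, hf₀p]
      exact Metric.mem_ball_self hε
    have hA := (hsymm' 0 h0t).1
    have hfp : f.symm 0 = p := by
      rw [← hf₀p, ← hff₀]
      exact f.left_inv hpf
    have h1 : HasFDerivAt (st ∘ f.symm) _ (0 : Fin 3 → ℂ) :=
      HasFDerivAt.comp (g := st) (g' := fderiv ℂ st p) (0 : Fin 3 → ℂ)
        (by rw [hfp]; exact hstan.differentiableAt.hasFDerivAt) hA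
    have h2 : HasFDerivAt (st ∘ f.symm) (ContinuousLinearMap.id ℂ (Fin 3 → ℂ)) 0 := by
      refine (hasFDerivAt_id (0 : Fin 3 → ℂ)).congr_of_eventuallyEq ?_
      filter_upwards [f.open_target.mem_nhds h0t] with x hx
      exact hst_symm x hx
    have h3 : fderiv ℂ st p (fderiv ℂ f.symm 0 w) 2 = w 2 :=
      congrArg (fun A => A w 2) (h1.unique h2)
    rw [hst'] at h3
    have h4 : Complex.I * d * fderiv ℂ Θ (diag p) (fderiv ℂ f.symm 0 w, 0) = w 2 := h3
    have h5 := hRΘ (fderiv ℂ f.symm 0 w, 0)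
    rw [← h4]
    linear_combination h5 - d * fderiv ℂ Θ (diag p) (fderiv ℂ f.symm 0 w, 0) * Complex.I_mul_I
  · have hz : f.symm c ∈ Metric.ball p δ ∧ (f.symm c ∈ M ↔ R (diag (f.symm c)) = 0) := by
      rw [hfsymm]
      exact (hT c hc).2.1
    have hz' : f.symm c' ∈ Metric.ball p δ ∧ (f.symm c' ∈ M ↔ R (diag (f.symm c')) = 0) := by
      rw [hfsymm]
      exact (hT c' hc').2.1
    have hswitch : ∀ {ζ}, ζ ∈ Metric.ball p δ →
        (R (f.symm c, star ζ) = 0 ↔ R (f.symm c', star ζ) = 0) := fun {ζ} hζ => by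
      rw [(hball _ (hpair hz.1 hζ)).1.1, (hball _ (hpair hz'.1 hζ)).1.1,
        hconst ζ hζ c hc c' hc' h0 h2]
    -- Only the `z`-slot can be switched directly. Hermitian symmetry exchanges the slots, so two
    -- switches with one conjugation between them lead from the diagonal point of `c` to that of
    -- `c'`.
    have hconj : R (f.symm c', star (f.symm c)) = 0 ↔ R (f.symm c, star (f.symm c')) = 0 := by
      have h1 := (hball _ (hpair hz.1 hz'.1)).1.2
      have h2 : conjVec ((f.symm c, star (f.symm c')) : CVec 3) =
          (f.symm c', star (f.symm c)) := by simp [conjVec]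
      rw [h2] at h1
      rw [h1, star_eq_zero]
    rw [hz.2, hz'.2, diag_apply, diag_apply, hswitch hz.1, hconj, hswitch hz'.1]

end CRGeom

/-! ### From invariant coordinates to a graph and to a product. -/

namespace CRGeom

variable {M : Set (Fin 3 → ℂ)} {R : CVec 3 → ℂ} {p : Fin 3 → ℂ}

/-- The slice `z₂ = 0` of `ℂ³` with real coordinates `((z₁, u), v)`, `w = u + i v`. -/
def slice : (ℂ × ℝ) × ℝ →L[ℝ] Fin 3 → ℂ :=
  ContinuousLinearMap.pi ![(ContinuousLinearMap.fst ℝ ℂ ℝ).comp (.fst ℝ (ℂ × ℝ) ℝ), 0,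
    (Complex.equivRealProdCLM.symm : ℝ × ℝ →L[ℝ] ℂ).comp
      (((ContinuousLinearMap.snd ℝ ℂ ℝ).comp (.fst ℝ (ℂ × ℝ) ℝ)).prod (.snd ℝ (ℂ × ℝ) ℝ))]

lemma slice_apply (x : (ℂ × ℝ) × ℝ) :
    slice x = ![x.1.1, 0, (x.1.2 : ℂ) + x.2 * Complex.I] := by
  ext i
  fin_cases i <;> simp [slice, Complex.equivRealProdCLM_symm_apply]

lemma slice_re_im (c : Fin 3 → ℂ) : slice ((c 0, (c 2).re), (c 2).im) = ![c 0, 0, c 2] := by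
  rw [slice_apply]
  simp [Complex.re_add_im]

lemma IsDefiningAt.fderiv_diag_eq (h : IsDefiningAt M R p) (a : Fin 3 → ℂ) :
    fderiv ℂ R (diag p) (diag a) = (2 * (fderiv ℂ R (diag p) (a, 0)).re : ℝ) := by
  have h1 : diag a = (a, 0) + conjVec (a, 0) := by simp [conjVec, diag_apply]
  rw [h1, map_add, h.fderiv_conjVec]
  apply Complex.ext <;> simp
  ring

/-- By invariance, membership in `M` can be tested on the slice `z₂ = 0`. There the defining
function has differential `2 Re (i dw) = -2 dv` at `0`, so it can be solved for `v`, with a solution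
whose differential at `0` is zero. -/
lemma IsDefiningAt.isLocallyGraph (h : IsDefiningAt M R p) (hp : p ∈ M)
    {f : OpenPartialHomeomorph (Fin 3 → ℂ) (Fin 3 → ℂ)} (hf : IsBiholomorphism f)
    (hpf : p ∈ f.source) (hfp : f p = 0)
    (hder : ∀ w, fderiv ℂ R (diag p) (fderiv ℂ f.symm 0 w, 0) = Complex.I * w 2)
    (hinv : ∀ c ∈ f.target, ∀ c' ∈ f.target, c 0 = c' 0 → c 2 = c' 2 →
      (f.symm c ∈ M ↔ f.symm c' ∈ M)) :
    IsLocallyGraphIndependentOfZ2At M p := by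
  have h0t : (0 : Fin 3 → ℂ) ∈ f.target := hfp ▸ f.map_source hpf
  have hf0 : f.symm 0 = p := by rw [← hfp]; exact f.left_inv hpf
  have hfsan : AnalyticAt ℝ f.symm 0 := (hf.2 0 h0t).restrictScalars (𝕜 := ℝ)
  have hs0 : slice 0 = 0 := map_zero _
  have hRd : AnalyticAt ℝ (fun q => (R (diag q)).re) p :=
    (Complex.reCLM.analyticAt _).comp (AnalyticAt.comp (g := R) (f := diag)
      (h.analyticAt.restrictScalars (𝕜 := ℝ)) (diag.analyticAt p))
  have hRd' : HasFDerivAt (fun q => (R (diag q)).re) _ p :=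
    Complex.reCLM.hasFDerivAt.comp p (hasFDerivAt_comp_diag h.analyticAt.differentiableAt
      (f := fun q => R (diag q)) (Eventually.of_forall fun _ => rfl))
  set ρ : (ℂ × ℝ) × ℝ → ℝ := fun x => (R (diag (f.symm (slice x)))).re with hρ
  have hsf : AnalyticAt ℝ (fun x => f.symm (slice x)) 0 :=
    hfsan.comp_of_eq (slice.analyticAt 0) hs0
  have hρan : AnalyticAt ℝ ρ (0, 0) := hRd.comp_of_eq hsf (by
    rw [show ((0, 0) : (ℂ × ℝ) × ℝ) = 0 from rfl, hs0, hf0])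
  have hρ0 : ρ (0, 0) = 0 := by
    have h1 : R (diag p) = 0 := h.mem_iff.self_of_nhds.1 hp
    rw [hρ, show ((0, 0) : (ℂ × ℝ) × ℝ) = 0 from rfl]
    simp only
    rw [hs0, hf0, h1, Complex.zero_re]
  have hρ' : ∀ y, fderiv ℝ ρ (0, 0) y = -2 * y.2 := fun y => by
    have h1 : HasFDerivAt (fun x => f.symm (slice x))
        (((fderiv ℂ f.symm 0).restrictScalars ℝ).comp slice) ((0, 0) : (ℂ × ℝ) × ℝ) :=
      HasFDerivAt.comp (g := f.symm) (g' := (fderiv ℂ f.symm 0).restrictScalars ℝ)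
        ((0, 0) : (ℂ × ℝ) × ℝ) (by
          rw [show slice (0, 0) = 0 from hs0]
          exact (hf.2 0 h0t).differentiableAt.hasFDerivAt.restrictScalars ℝ) slice.hasFDerivAt
    have h2 : HasFDerivAt ρ _ (0, 0) := HasFDerivAt.comp (g := fun q => (R (diag q)).re)
      ((0, 0) : (ℂ × ℝ) × ℝ) (by
        rw [show f.symm (slice (0, 0)) = p by
          rw [show slice (0, 0) = 0 from hs0, hf0]]
        exact hRd') h1
    rw [h2.fderiv]
    simp only [ContinuousLinearMap.comp_apply, ContinuousLinearMap.coe_restrictScalars',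
      Complex.reCLM_apply]
    rw [h.fderiv_diag_eq, hder, slice_apply]
    simp
  obtain ⟨φ, hφan, hφ0, hφsol, hφiff⟩ := exists_analyticAt_implicit hρan
    (by rw [hρ']; norm_num)
  rw [hρ0] at hφsol hφiff
  have hφ' : fderiv ℝ φ 0 = 0 := by
    have h1 : HasFDerivAt (fun x => ρ (x, φ x)) _ (0 : ℂ × ℝ) :=
      HasFDerivAt.comp (g := ρ) (g' := fderiv ℝ ρ (0, 0)) (0 : ℂ × ℝ)
        (by rw [hφ0]; exact hρan.differentiableAt.hasFDerivAt)
        ((hasFDerivAt_id (0 : ℂ × ℝ)).prodMk hφan.differentiableAt.hasFDerivAt)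
    have h2 := h1.unique ((hasFDerivAt_const (0 : ℝ) _).congr_of_eventuallyEq hφsol)
    refine ContinuousLinearMap.ext fun x => ?_
    have h3 := congrArg (fun A => A x) h2
    simp only [ContinuousLinearMap.comp_apply, hρ'] at h3
    simpa using h3
  -- shrink the coordinate neighbourhood
  have ht1 : Tendsto (fun c : Fin 3 → ℂ => (c 0, (c 2).re)) (𝓝 0) (𝓝 0) := by
    have : Continuous (fun c : Fin 3 → ℂ => (c 0, (c 2).re)) := by fun_prop
    exact this.tendsto' _ _ (by simp)
  have ht2 : Tendsto (fun c : Fin 3 → ℂ => ((c 0, (c 2).re), (c 2).im)) (𝓝 0) (𝓝 (0, 0)) := by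
    have : Continuous (fun c : Fin 3 → ℂ => ((c 0, (c 2).re), (c 2).im)) := by fun_prop
    exact this.tendsto' _ _ (by simp)
  have ht3 : Tendsto (fun c : Fin 3 → ℂ => (![c 0, 0, c 2] : Fin 3 → ℂ)) (𝓝 0) (𝓝 0) := by
    have := (slice.continuous.tendsto (0, 0)).comp ht2
    rw [show slice (0, 0) = 0 from hs0] at this
    refine this.congr fun c => slice_re_im c
  have ht4 : Tendsto (fun c : Fin 3 → ℂ => f.symm ![c 0, 0, c 2]) (𝓝 0) (𝓝 p) := by
    have := hfsan.continuousAt.tendsto.comp ht3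
    rwa [hf0] at this
  have hev := ((ht1.eventually hφan.eventually_analyticAt).and (ht2.eventually hφiff)).and
    ((ht3.eventually (f.open_target.mem_nhds h0t)).and
      (ht4.eventually (h.mem_iff.and h.im_eq_zero)))
  rw [← hfp] at hev
  obtain ⟨f', hf'f, hf's, hpf', hsub, ε, hε, htgt, hT⟩ := exists_restr_ball f hpf hev
  have hMiff : ∀ c ∈ f'.target, f'.symm c ∈ M ↔ (c 2).im = φ (c 0, (c 2).re) := fun c hc => by
    obtain ⟨hct, ⟨-, h1⟩, h2, h3, h4⟩ := hT c hc
    rw [hf's, hinv c hct _ h2 rfl rfl, h3, eq_comm (a := (c 2).im), ← h1]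
    simp only [hρ]
    rw [slice_re_im]
    exact ⟨fun h5 => by rw [h5, Complex.zero_re], fun h5 => Complex.ext h5 h4⟩
  refine ⟨f', ⟨fun z hz => ?_, fun c hc => ?_⟩, hpf', by rw [hf'f, hfp], φ, hφ0, hφ',
    fun c hc => (hT c hc).2.1.1, ?_⟩
  · rw [hf'f]
    exact hf.1 z (hsub hz)
  · rw [hf's]
    exact hf.2 c (hT c hc).1
  · ext c
    constructor
    · rintro ⟨q, ⟨hqM, hqs⟩, rfl⟩
      have hc := f'.map_source hqs
      refine ⟨hc, (hMiff _ hc).1 ?_⟩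
      rwa [f'.left_inv hqs]
    · rintro ⟨hc, hc2⟩
      exact ⟨f'.symm c, ⟨(hMiff c hc).2 hc2, f'.map_target hc⟩, f'.right_inv hc⟩

/-- The same equation, read on a ball of `ℂ²`, defines `M³`. Shrinking the target to a polydisc
makes the projection to `(z₁, w)` land in that ball, and lets each point of the ball be lifted with
`z₂ = 0`, where `φ` is known to be analytic. -/
lemma IsLocallyGraphIndependentOfZ2At.isLocallyProductAt
    (hg : IsLocallyGraphIndependentOfZ2At M p) : IsLocallyProductAt M p := by
  obtain ⟨f, hf, hpf, hfp, φ, -, -, hφ, hM⟩ := hg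
  obtain ⟨f', hf'f, hf's, hpf', hsub, ε, hε, htgt, hT⟩ :=
    exists_restr_ball f hpf (T := fun _ => True) (Eventually.of_forall fun _ => trivial)
  rw [hfp] at htgt
  have hext : ∀ x ∈ Metric.ball (0 : Fin 2 → ℂ) ε, (![x 0, 0, x 1] : Fin 3 → ℂ) ∈ f.target :=
    fun x hx => by
      refine (hT _ ?_).1
      rw [htgt]
      rw [mem_ball_zero_iff, pi_norm_lt_iff hε] at hx ⊢
      intro i
      fin_cases i
      · exact hx 0
      · simpa using hε
      · exact hx 1
  refine ⟨f', ⟨fun z hz => ?_, fun c hc => ?_⟩, hpf',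
    {x | x ∈ Metric.ball 0 ε ∧ (x 1).im = φ (x 0, (x 1).re)}, fun x hx => ?_, ?_⟩
  · rw [hf'f]
    exact hf.1 z (hsub hz)
  · rw [hf's]
    exact hf.2 c (hT c hc).1
  · refine ⟨Metric.ball 0 ε, Metric.isOpen_ball, hx.1, fun x => (x 1).im - φ (x 0, (x 1).re),
      fun y hy => ?_, fun y hy => ?_, fun y hy => ?_⟩
    · have h1 : AnalyticAt ℝ φ (y 0, (y 1).re) := hφ _ (hext y hy)
      let L0 : (Fin 2 → ℂ) →L[ℝ] ℂ := ContinuousLinearMap.proj 0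
      let L1 : (Fin 2 → ℂ) →L[ℝ] ℂ := ContinuousLinearMap.proj 1
      exact ((Complex.imCLM.comp L1).analyticAt y).sub
        (AnalyticAt.comp (g := φ) (f := L0.prod (Complex.reCLM.comp L1)) h1
          (ContinuousLinearMap.analyticAt _ y))
    · exact ⟨fun h => sub_eq_zero.2 h.2, fun h => ⟨hy, sub_eq_zero.1 h⟩⟩
    · intro h0
      have h1 : AnalyticAt ℝ φ (y 0, (y 1).re) := hφ _ (hext y hy)
      let L0 : (Fin 2 → ℂ) →L[ℝ] ℂ := ContinuousLinearMap.proj 0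
      let L1 : (Fin 2 → ℂ) →L[ℝ] ℂ := ContinuousLinearMap.proj 1
      have h2 : HasFDerivAt (fun x : Fin 2 → ℂ => (x 1).im - φ (x 0, (x 1).re)) _ y :=
        ((Complex.imCLM.comp L1).hasFDerivAt (x := y)).sub
        (HasFDerivAt.comp (g := φ) (f := L0.prod (Complex.reCLM.comp L1)) y
          h1.differentiableAt.hasFDerivAt (ContinuousLinearMap.hasFDerivAt _))
      -- The direction `∂/∂v` changes neither `z₁` nor `u`, so `φ` contributes nothing and the
      -- derivative is `1`.
      have h3 := congrArg (fun A => A ![0, Complex.I]) (h2.fderiv.symm.trans h0)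
      have h4 : fderiv ℝ φ (y 0, (y 1).re) ((0 : ℂ), (0 : ℝ)) = 0 := map_zero _
      simp [L0, L1, h4] at h3
  · have hball : ∀ c ∈ f'.target, (![c 0, c 2] : Fin 2 → ℂ) ∈ Metric.ball 0 ε := fun c hc => by
      rw [htgt, mem_ball_zero_iff, pi_norm_lt_iff hε] at hc
      rw [mem_ball_zero_iff, pi_norm_lt_iff hε]
      intro i
      fin_cases i
      · exact hc 0
      · exact hc 2
    have key : ∀ c ∈ f.target, f.symm c ∈ M ↔ (c 2).im = φ (c 0, (c 2).re) := fun c hc => by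
      have h1 : c ∈ f '' (M ∩ f.source) ↔ c ∈ f.target ∧ (c 2).im = φ (c 0, (c 2).re) := by
        rw [hM]
        rfl
      constructor
      · intro h2
        exact (h1.1 ⟨_, ⟨h2, f.map_target hc⟩, f.right_inv hc⟩).2
      · intro h2
        obtain ⟨q, ⟨hqM, hqs⟩, rfl⟩ := h1.2 ⟨hc, h2⟩
        rwa [f.left_inv hqs]
    ext c
    constructor
    · rintro ⟨q, ⟨hqM, hqs⟩, rfl⟩
      have hc := f'.map_source hqs
      refine ⟨⟨hball _ hc, (key _ (hT _ hc).1).1 ?_⟩, hc⟩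
      rwa [← hf's, f'.left_inv hqs]
    · rintro ⟨⟨-, hc2⟩, hc⟩
      refine ⟨f'.symm c, ⟨?_, f'.map_target hc⟩, f'.right_inv hc⟩
      rw [hf's]
      exact (key c (hT c hc).1).2 hc2

/-- If the Freeman form vanishes, then `M` is locally a graph independent of `z₂`. -/
lemma isLocallyGraph_of_freemanForm_eq_zero (hM : IsRealAnalyticHypersurface M)
    (hrank : ∀ q ∈ M, leviRank M q = 1) (hF : ∀ q ∈ M, freemanForm M q = 0) (hp : p ∈ M) :
    IsLocallyGraphIndependentOfZ2At M p := by
  obtain ⟨R, h⟩ := hM.exists_isDefiningAt hp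
  obtain ⟨K, j, hK, hKj, hKker, hzero, w, hw, hnd⟩ := h.exists_leviKernel_section hp hrank
  have hCR := h.along_leviKernel_section_eq_zero hF hK hKj hKker hzero
  obtain ⟨e, he⟩ := h.exists_snd
  obtain ⟨Θ, hΘ⟩ := h.exists_isSegreSolution hp he
  have hKtan : ∀ᶠ q in 𝓝[M] p, (K q, 0) ∈ complexTangent M q := by
    filter_upwards [hKker, self_mem_nhdsWithin, h.eventually.filter_mono nhdsWithin_le_nhds]
      with q h1 h2 h3
    exact ((h3.mem_leviKernel h2).1 h1).1.2
  obtain ⟨k, hk, hkj, hkΘ⟩ := h.exists_holomorphic_extension hp he hΘ hK hKtan hCR hKj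
  have hw' := conjVec_mem_T01 hw
  have hwb : conjVec w = (0, star w.1) := by
    simp [conjVec, (mem_T10.1 hw).1]
  obtain ⟨f, hf, hpf, hfp, hder, -, -, -, hinv⟩ :=
    hΘ.exists_straightening h he hk hkj hkΘ (b := star w.1)
      (by rw [← hwb]; exact (h.mem_complexTangent hp).1 hw'.2) (fun a h1 h2 h3 => by
        have h4 := hnd (a, 0) (mem_T10.2 ⟨rfl, (h.mem_complexTangent hp).2 h1⟩)
          (by rw [hwb]; exact h2) h3
        exact congrArg Prod.fst h4)
  exact h.isLocallyGraph hp hf hpf hfp hder hinv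

end CRGeom

namespace CRGeom

variable {M : Set (Fin 3 → ℂ)} {R : CVec 3 → ℂ} {p : Fin 3 → ℂ}

/-! ### Products have vanishing Freeman form -/

lemma fderiv_eq_zero_of_mem_complexTangent {n : ℕ} {M : Set (Fin n → ℂ)} {p : Fin n → ℂ}
    {g : CVec n → CVec n} (hg : AnalyticAt ℂ g (diag p)) (h0 : ∀ᶠ q in 𝓝[M] p, g (diag q) = 0)
    {w : CVec n} (hw : w ∈ complexTangent M p) : fderiv ℂ g (diag p) w = 0 := by
  have hV : AnalyticAt ℝ (fun q => g (diag q)) p :=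
    AnalyticAt.comp (g := g) (f := diag) (hg.restrictScalars (𝕜 := ℝ)) (diag.analyticAt p)
  ext k
  · rw [← along_fst_eq hg.differentiableAt (V := fun q => g (diag q))
      (Eventually.of_forall fun _ => rfl)]
    exact hw _ (analyticAt_fst hV k) (by filter_upwards [h0] with q hq; rw [hq]; rfl)
  · rw [← along_snd_eq hg.differentiableAt (V := fun q => g (diag q))
      (Eventually.of_forall fun _ => rfl)]
    exact hw _ (analyticAt_snd hV k) (by filter_upwards [h0] with q hq; rw [hq]; rfl)

lemma hasFDerivAt_holomorphic_field {z : (Fin 3 → ℂ) → Fin 3 → ℂ} {q : Fin 3 → ℂ}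
    (hz : DifferentiableAt ℂ z q) : HasFDerivAt (fun y : CVec 3 => ((z y.1, 0) : CVec 3))
      (((fderiv ℂ z q).comp (.fst ℂ _ _)).prod 0) (diag q) :=
  (HasFDerivAt.comp (g := z) (diag q) hz.hasFDerivAt hasFDerivAt_fst).prodMk
    (hasFDerivAt_const (0 : Fin 3 → ℂ) (diag q))

/-- A holomorphic field tangent to `M` takes values in the Levi kernel. -/
lemma IsDefiningAt.holomorphic_mem_leviKernel (h : IsDefiningAt M R p) (hp : p ∈ M)
    {z : (Fin 3 → ℂ) → Fin 3 → ℂ} (hz : AnalyticAt ℂ z p)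
    (hzM : ∀ᶠ q in 𝓝[M] p, (z q, 0) ∈ complexTangent M q) : (z p, 0) ∈ leviKernel M p := by
  rw [h.mem_leviKernel hp]
  refine ⟨mem_T10.2 ⟨rfl, hzM.self_of_nhdsWithin hp⟩, fun w hw => ?_⟩
  have hw' := conjVec_mem_T01 hw
  have hg : AnalyticAt ℂ (fun y : CVec 3 => ((z y.1, 0) : CVec 3)) (diag p) :=
    (AnalyticAt.comp (g := z) hz _root_.analyticAt_fst).prod analyticAt_const
  have hV : (fun q => (z q, 0) : CField 3) ∈ sections M (complexTangent M) p :=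
    ⟨(hz.restrictScalars (𝕜 := ℝ)).prod analyticAt_const, hzM⟩
  have h1 := h.fderiv_section hg (Eventually.of_forall fun _ => rfl) hV hw'.2
  rw [(hasFDerivAt_holomorphic_field hz.differentiableAt).fderiv] at h1
  -- A holomorphic field has zero derivative along (0,1)-vectors, so the differentiated tangency
  -- relation reduces to the vanishing of the mixed Hessian.
  have h2 : ((((fderiv ℂ z p).comp (.fst ℂ _ _)).prod 0 : CVec 3 →L[ℂ] CVec 3) (conjVec w)) =
      0 := by
    have h3 : (conjVec w).1 = 0 := (mem_T01.1 hw').1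
    refine Prod.ext ?_ rfl
    simp [h3]
  rw [h2, map_zero] at h1
  exact neg_eq_zero.1 h1.symm

/-- If `M` has a nowhere vanishing holomorphic tangent field, its Freeman form vanishes. -/
lemma IsDefiningAt.freemanForm_eq_zero (h : IsDefiningAt M R p) (hp : p ∈ M)
    (hrank : ∀ q ∈ M, leviRank M q = 1)
    {z : (Fin 3 → ℂ) → Fin 3 → ℂ} (hz : AnalyticAt ℂ z p) (hz0 : z p ≠ 0)
    (hzM : ∀ᶠ q in 𝓝[M] p, (z q, 0) ∈ complexTangent M q) : freemanForm M p = 0 := by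
  obtain ⟨-, j, -, -, -, hzero, -⟩ := h.exists_leviKernel_section hp hrank
  have hzK : ∀ᶠ q in 𝓝[M] p, (z q, 0) ∈ leviKernel M q := by
    filter_upwards [eventually_eventually_nhdsWithin.2 hzM, self_mem_nhdsWithin,
      h.eventually.filter_mono nhdsWithin_le_nhds,
      hz.eventually_analyticAt.filter_mono nhdsWithin_le_nhds] with q h1 h2 h3 h4
    exact h3.holomorphic_mem_leviKernel h2 h4 h1
  have hzKp := hzK.self_of_nhdsWithin hp
  have hzj : z p j ≠ 0 := fun h0 =>
    hz0 (congrArg Prod.fst (hzero.self_of_nhdsWithin hp _ hzKp h0))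
  have hzR : AnalyticAt ℝ (fun q => z q j) p :=
    analyticAt_pi_iff.1 (hz.restrictScalars (𝕜 := ℝ)) j
  refine LinearMap.ext fun V => LinearMap.ext fun W => ?_
  have hW := conjField_mem W.2
  have hWp := hW.2.self_of_nhdsWithin hp
  have hVT : (V : CField 3) ∈ sections M (T10 M) p := by
    refine ⟨V.2.1, ?_⟩
    filter_upwards [V.2.2, self_mem_nhdsWithin, h.eventually.filter_mono nhdsWithin_le_nhds]
      with q h1 h2 h3 using ((h3.mem_leviKernel h2).1 h1).1
  have hVp := V.2.2.self_of_nhdsWithin hp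
  refine (Submodule.Quotient.mk_eq_zero _).2 ?_
  -- the bracket is tangent, since `V` is in the kernel of the Levi form
  have hlevi : bracket (V : CField 3) (conjField (W : CField 3)) p ∈ T10 M p ⊔ T01 M p := by
    have h1 := (h.leviForm_eq_zero_iff hp ⟨V, hVT⟩ W).2
      (((h.mem_leviKernel hp).1 hVp).2 _ (W.2.2.self_of_nhdsWithin hp))
    have h2 : Complex.I • (T10 M p ⊔ T01 M p).mkQ
      (bracket (V : CField 3) (conjField (W : CField 3)) p) = 0 := h1
    rwa [smul_eq_zero_iff_right Complex.I_ne_zero, Submodule.mkQ_apply,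
      Submodule.Quotient.mk_eq_zero] at h2
  have h01 := (mem_T10_sup_T01.1 hlevi).2
  obtain ⟨g, hg, hgV⟩ := exists_complexification V.2.1
  have h10 := bracket_fst hp hVT hW hg.differentiableAt hgV
  -- `V` is a multiple of the holomorphic field
  have hφ : AnalyticAt ℝ (fun q => ((V : CField 3) q).1 j / z q j) p :=
    (analyticAt_fst V.2.1 j).div hzR hzj
  obtain ⟨ψ, hψ, hψφ⟩ := exists_complexification hφ
  have hG : AnalyticAt ℂ (fun y : CVec 3 => ((z y.1, 0) : CVec 3)) (diag p) :=
    (AnalyticAt.comp (g := z) hz _root_.analyticAt_fst).prod analyticAt_const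
  -- On `M`, the difference between `V` and `V_j / z_j` times the holomorphic field is a kernel
  -- vector with zero `j`-th coefficient, hence zero; so its derivative along the tangent vector
  -- `W̄` vanishes.
  have hdiff := fderiv_eq_zero_of_mem_complexTangent (hg.sub (hψ.smul hG)) (M := M) (p := p) (by
    filter_upwards [V.2.2, hzK, hzero, hgV.filter_mono nhdsWithin_le_nhds,
      hψφ.filter_mono nhdsWithin_le_nhds,
      (hzR.continuousAt.eventually_ne hzj).filter_mono nhdsWithin_le_nhds] with q h1 h2 h3 h4 h5 h6
    have h7 := h3 _ (Submodule.sub_mem _ h1 (Submodule.smul_mem _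
      (((V : CField 3) q).1 j / z q j) h2)) (by simp [h6])
    have h8 : g (diag q) - ψ (diag q) • ((z (diag q).1, 0) : CVec 3) = 0 := by
      rw [h4, h5]
      exact h7
    exact h8) hWp.2
  have hz' := (hasFDerivAt_holomorphic_field hz.differentiableAt)
  have h2 : ((((fderiv ℂ z p).comp (.fst ℂ _ _)).prod 0 : CVec 3 →L[ℂ] CVec 3)
      (conjField (W : CField 3) p)) = 0 := by
    have h3 : (conjField (W : CField 3) p).1 = 0 := (mem_T01.1 hWp).1
    refine Prod.ext ?_ rfl
    simp [h3]
  have hsub := hg.differentiableAt.hasFDerivAt.sub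
    (hψ.differentiableAt.hasFDerivAt.smul hz')
  have hsub' : fderiv ℂ (g - ψ • fun y : CVec 3 => ((z y.1, 0) : CVec 3)) (diag p) = _ :=
    hsub.fderiv
  rw [hsub'] at hdiff
  have hfin : fderiv ℂ g (diag p) (conjField (W : CField 3) p) =
      fderiv ℂ ψ (diag p) (conjField (W : CField 3) p) • (z p, 0) := by
    simp only [sub_apply, add_apply, smul_apply, ContinuousLinearMap.smulRight_apply, h2,
      smul_zero, zero_add] at hdiff
    exact sub_eq_zero.1 hdiff
  have hsplit : bracket (V : CField 3) (conjField (W : CField 3)) p =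
      ((bracket (V : CField 3) (conjField (W : CField 3)) p).1, 0) +
        (0, (bracket (V : CField 3) (conjField (W : CField 3)) p).2) := by simp
  rw [hsplit]
  refine Submodule.add_mem_sup ?_ h01
  rw [h10, hfin]
  exact Submodule.neg_mem _ (Submodule.smul_mem _ _ hzKp)

/-- The holomorphic tangent field required by `IsDefiningAt.freemanForm_eq_zero` is `∂/∂z₂` of the
product, transported by the inverse chart. -/
lemma IsLocallyProductAt.freemanForm_eq_zero (hM : IsRealAnalyticHypersurface M) (hp : p ∈ M)
    (hrank : ∀ q ∈ M, leviRank M q = 1) (hprod : IsLocallyProductAt M p) :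
    freemanForm M p = 0 := by
  obtain ⟨R, h⟩ := hM.exists_isDefiningAt hp
  obtain ⟨f, hf, hpf, N, -, hfM⟩ := hprod
  have key : ∀ c ∈ f.target, f.symm c ∈ M ↔ ![c 0, c 2] ∈ N := fun c hc => by
    have h1 : c ∈ f '' (M ∩ f.source) ↔ ![c 0, c 2] ∈ N ∧ c ∈ f.target := by
      rw [hfM]
      rfl
    constructor
    · intro h2
      exact (h1.1 ⟨_, ⟨h2, f.map_target hc⟩, f.right_inv hc⟩).1
    · intro h2
      obtain ⟨q, ⟨hqM, hqs⟩, rfl⟩ := h1.2 ⟨h2, hc⟩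
      rwa [f.left_inv hqs]
  have hz : AnalyticAt ℂ (fun q => fderiv ℂ f.symm (f q) (Pi.single 1 1)) p :=
    analyticAt_clm_apply (AnalyticAt.comp (g := fderiv ℂ f.symm)
      (hf.2 _ (f.map_source hpf)).fderiv (hf.1 p hpf)) analyticAt_const
  refine h.freemanForm_eq_zero hp hrank hz ?_ ?_
  · intro h0
    have hfp := f.map_source hpf
    have h1 := HasFDerivAt.comp (g := f) (g' := fderiv ℂ f p) (f p)
      (by rw [f.left_inv hpf]; exact (hf.1 p hpf).differentiableAt.hasFDerivAt)
      (hf.2 _ hfp).differentiableAt.hasFDerivAt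
    have h2 := h1.unique ((hasFDerivAt_id (f p)).congr_of_eventuallyEq (by
      filter_upwards [f.open_target.mem_nhds hfp] with c hc
      exact f.right_inv hc))
    have h3 := congrArg (fun A => A (Pi.single 1 1)) h2
    simp only [ContinuousLinearMap.comp_apply, h0, map_zero] at h3
    have h4 := congrFun h3 1
    simp at h4
  · filter_upwards [self_mem_nhdsWithin, h.eventually.filter_mono nhdsWithin_le_nhds,
      (f.open_source.eventually_mem hpf).filter_mono nhdsWithin_le_nhds]
      with q hq h1 hqf
    set v := fderiv ℂ f.symm (f q) (Pi.single 1 1) with hv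
    have hfq := f.map_source hqf
    -- The real lines in the complex `z₂`-direction stay in `M`, which gives only the real part of
    -- `dR(a v, 0)`. Taking `a = 1` and `a = i` yields both parts of `dR(v, 0)`.
    have hline : ∀ a : ℂ, (fderiv ℂ R (diag q) (a • v, 0)).re = 0 := fun a => by
      have hc : HasDerivAt (fun t : ℝ => f q + t • (Pi.single 1 a : Fin 3 → ℂ))
          (Pi.single 1 a) 0 := by
        simpa using ((hasDerivAt_id (0 : ℝ)).smul_const (Pi.single 1 a : Fin 3 → ℂ)).const_add (f q)
      have hs : HasDerivAt (fun t : ℝ => f.symm (f q + t • (Pi.single 1 a : Fin 3 → ℂ)))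
          (fderiv ℂ f.symm (f q) (Pi.single 1 a)) 0 :=
        HasFDerivAt.comp_hasDerivAt_of_eq (0 : ℝ)
          ((hf.2 _ hfq).differentiableAt.hasFDerivAt.restrictScalars ℝ) hc (by simp)
      have hR : HasDerivAt (fun t : ℝ => R (diag (f.symm (f q + t • (Pi.single 1 a : Fin 3 → ℂ)))))
          (fderiv ℂ R (diag q) (diag (fderiv ℂ f.symm (f q) (Pi.single 1 a)))) 0 :=
        HasFDerivAt.comp_hasDerivAt_of_eq (0 : ℝ)
          (hasFDerivAt_comp_diag h1.analyticAt.differentiableAt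
            (f := fun q => R (diag q)) (Eventually.of_forall fun _ => rfl)) hs
          (by simp [f.left_inv hqf])
      have hzero : ∀ᶠ t : ℝ in 𝓝 0,
          R (diag (f.symm (f q + t • (Pi.single 1 a : Fin 3 → ℂ)))) = 0 := by
        have ht1 : Tendsto (fun t : ℝ => f q + t • (Pi.single 1 a : Fin 3 → ℂ)) (𝓝 0)
            (𝓝 (f q)) := by simpa [ContinuousAt] using hc.continuousAt
        have ht2 : Tendsto (fun t : ℝ => f.symm (f q + t • (Pi.single 1 a : Fin 3 → ℂ))) (𝓝 0)
            (𝓝 q) := by simpa [ContinuousAt, f.left_inv hqf] using hs.continuousAt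
        filter_upwards [ht1.eventually (f.open_target.mem_nhds hfq), ht2.eventually h1.mem_iff]
          with t h2 h3
        rw [← h3, key _ h2]
        have h4 := (key _ hfq).1 (by rwa [f.left_inv hqf])
        simpa using h4
      have h2 := hR.unique ((hasDerivAt_const (0 : ℝ) (0 : ℂ)).congr_of_eventuallyEq hzero)
      have h3 : (Pi.single 1 a : Fin 3 → ℂ) = a • Pi.single 1 1 := by
        rw [← Pi.single_smul, smul_eq_mul, mul_one]
      rw [h1.fderiv_diag_eq, h3, map_smul] at h2
      have h4 : 2 * (fderiv ℂ R (diag q) (a • v, 0)).re = 0 := by exact_mod_cast h2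
      linarith
    rw [h1.mem_complexTangent hq]
    have e1 := hline 1
    have e2 := hline Complex.I
    have h3 : ((Complex.I • v, 0) : CVec 3) = Complex.I • (v, 0) := by simp
    rw [one_smul] at e1
    rw [h3, map_smul] at e2
    exact Complex.ext e1 (by simpa using e2)

end CRGeom

end

theorem mainTheorem4 (M : Set (Fin 3 → ℂ)) (hM : CRGeom.IsRealAnalyticHypersurface M)
    (hLevi : ∀ p ∈ M, CRGeom.leviRank M p = 1) :
    ((∀ p ∈ M, CRGeom.freemanForm M p = 0) ↔ ∀ p ∈ M, CRGeom.IsLocallyProductAt M p) ∧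
    ((∀ p ∈ M, CRGeom.freemanForm M p = 0) →
      ∀ p ∈ M, CRGeom.IsLocallyGraphIndependentOfZ2At M p) := by
  have h : (∀ p ∈ M, CRGeom.freemanForm M p = 0) →
      ∀ p ∈ M, CRGeom.IsLocallyGraphIndependentOfZ2At M p := fun hF _ hp =>
    CRGeom.isLocallyGraph_of_freemanForm_eq_zero hM hLevi hF hp
  exact ⟨⟨fun hF p hp => (h hF p hp).isLocallyProductAt,
    fun hP p hp => (hP p hp).freemanForm_eq_zero hM hp hLevi⟩, h⟩
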